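/- Let $M$ be a smooth $n$-dimensional manifold, $\pi\colon TM\to M$ its tangent bundle, and let $J=\frac{\partial}{\partial y^i}\otimes dx^i$ and $\mathbb C=y^i\frac{\partial}{\partial y^i}$ be the tangent structure and the Liouville vector field on $TM$. Let $S$ be a spray, that is, a smooth vector field on $TM\setminus\{0\}$ with $JS=\mathbb C$ and $[\mathbb C,S]=S$. Let $h=\frac12(\mathrm{Id}-\mathcal L_SJ)$ be the horizontal projector of the nonlinear connection induced by $S$, and let $R=\frac12[h,h]$ (Frölicher–Nijenhuis bracket) be its curvature. For a vector-valued $l$-form $L$ put $d_L=i_L\circ d+(-1)^l\,d\circ i_L$. A differential form on $TM\setminus\{0\}$ is semi-basic if it vanishes whenever one of its arguments is vertical, i.e. lies in $\ker d\pi$. Let $T^*_v$ be the bundle of semi-basic covectors on $TM\setminus\{0\}$, and let $P_1\theta=(\mathcal L_{\mathbb C}\theta,\,d_J\theta,\,d_h\theta)$, a first-order linear differential operator from sections of $T^*_v$ to sections of $F_1=T^*_v\oplus\Lambda^2T^*_v\oplus\Lambda^2T^*_v$. For $u\in TM\setminus\{0\}$ and $l\ge 0$ let $$R^{1+l}_u(P_1)=\{\,j^{1+l}_u\theta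 \;:\; j^l_u(P_1\theta)=0\,\}\subset J^{1+l}_uT^*_v$$ be the space of formal solutions of order $1+l$ at $u$ (here $\theta$ is a smooth local section of $T^*_v$ near $u$), and let $\overline\pi_1\colon R^2_u(P_1)\to R^1_u(P_1)$ be the projection $j^2_u\theta\mapsto j^1_u\theta$. Theorem. Let $u\in TM\setminus\{0\}$. (1) A first-order formal solution $j^1_u\theta\in R^1_u(P_1)$ can be lifted to a second-order formal solution, i.e. lies in the image of $\overline\pi_1\colon R^2_u(P_1)\to R^1_u(P_1)$, if and only if $(d_R\theta)_u=0$. (2) Consequently $\overline\pi_1\colon R^2_u(P_1)\to R^1_u(P_1)$ is onto if and only if $(d_R\theta)_u=0$ for every local section $\theta$ of $T^*_v$ near $u$ with $j^1_u\theta\in R^1_u(P_1)$. -/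

import Mathlib

open scoped Manifold ContDiff Topology

noncomputable section

namespace FrolicherNijenhuis

/-! ### Multilinear algebra: the inner product with a vector-valued form -/

section Pointwise

variable {V : Type*} [AddCommGroup V] [Module ℝ V] [TopologicalSpace V]

/-- The multilinear map
`(X₁, …, X_{l+k}) ↦ α (L (X₁, …, X_l), X_{l+1}, …, X_{l+k})`. -/
def insertion {k l : ℕ} (L : V [⋀^Fin l]→L[ℝ] V) (α : V [⋀^Fin (k + 1)]→L[ℝ] ℝ) :
    ContinuousMultilinearMap ℝ (fun _ : Fin (l + k) => V) ℝ where
  toFun X := α (Fin.cons (L fun i => X (Fin.castAdd k i)) fun j => X (Fin.natAdd l j))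
  map_update_add' := by
    intro inst X i x y
    obtain rfl : inst = instDecidableEqFin _ := Subsingleton.elim _ _
    refine Fin.addCases (fun i => ?_) (fun j => ?_) i
    · have h1 : ∀ z : V, (fun i' => Function.update X (Fin.castAdd k i) z (Fin.castAdd k i'))
          = Function.update (fun i' => X (Fin.castAdd k i')) i z := fun z =>
        Function.update_comp_eq_of_injective X (Fin.castAdd_injective l k) i z
      have h2 : ∀ z : V, (fun j => Function.update X (Fin.castAdd k i) z (Fin.natAdd l j))
          = fun j => X (Fin.natAdd l j) := fun z => by
        funext j
        exact Function.update_of_ne (by simp [Fin.ext_iff]; omega) _ _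
      simp only [h1, h2, ContinuousAlternatingMap.map_update_add]
      exact α.cons_add (fun j => X (Fin.natAdd l j)) _ _
    · have h1 : ∀ z : V, (fun i' => Function.update X (Fin.natAdd l j) z (Fin.castAdd k i'))
          = fun i' => X (Fin.castAdd k i') := fun z => by
        funext i'
        exact Function.update_of_ne (by simp [Fin.ext_iff]; omega) _ _
      have h2 : ∀ z : V, (fun j' => Function.update X (Fin.natAdd l j) z (Fin.natAdd l j'))
          = Function.update (fun j' => X (Fin.natAdd l j')) j z := fun z =>
        Function.update_comp_eq_of_injective X (Fin.natAdd_injective k l) j z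
      simp only [h1, h2, Fin.cons_update, ContinuousAlternatingMap.map_update_add]
  map_update_smul' := by
    intro inst X i c x
    obtain rfl : inst = instDecidableEqFin _ := Subsingleton.elim _ _
    refine Fin.addCases (fun i => ?_) (fun j => ?_) i
    · have h1 : ∀ z : V, (fun i' => Function.update X (Fin.castAdd k i) z (Fin.castAdd k i'))
          = Function.update (fun i' => X (Fin.castAdd k i')) i z := fun z =>
        Function.update_comp_eq_of_injective X (Fin.castAdd_injective l k) i z
      have h2 : ∀ z : V, (fun j => Function.update X (Fin.castAdd k i) z (Fin.natAdd l j))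
          = fun j => X (Fin.natAdd l j) := fun z => by
        funext j
        exact Function.update_of_ne (by simp [Fin.ext_iff]; omega) _ _
      simp only [h1, h2, ContinuousAlternatingMap.map_update_smul]
      exact α.cons_smul (fun j => X (Fin.natAdd l j)) c _
    · have h1 : ∀ z : V, (fun i' => Function.update X (Fin.natAdd l j) z (Fin.castAdd k i'))
          = fun i' => X (Fin.castAdd k i') := fun z => by
        funext i'
        exact Function.update_of_ne (by simp [Fin.ext_iff]; omega) _ _
      have h2 : ∀ z : V, (fun j' => Function.update X (Fin.natAdd l j) z (Fin.natAdd l j'))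
          = Function.update (fun j' => X (Fin.natAdd l j')) j z := fun z =>
        Function.update_comp_eq_of_injective X (Fin.natAdd_injective k l) j z
      simp only [h1, h2, Fin.cons_update, ContinuousAlternatingMap.map_update_smul]
  cont := by
    refine α.cont.comp (continuous_pi fun i => ?_)
    refine Fin.cases ?_ (fun j => ?_) i
    · exact L.cont.comp (continuous_pi fun i => continuous_apply (Fin.castAdd k i))
    · exact continuous_apply (Fin.natAdd l j)

/-- The inner product `i_L α` of a `(k+1)`-covector `α` with a vector-valued `l`-covector `L`:
`(i_L α)(X₁, …, X_{l+k}) =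
  1 / (k! l!) ∑_σ ε(σ) α (L (X_σ(1), …, X_σ(l)), X_σ(l+1), …, X_σ(l+k))`. -/
def innerProd {k l : ℕ} (L : V [⋀^Fin l]→L[ℝ] V) (α : V [⋀^Fin (k + 1)]→L[ℝ] ℝ) :
    V [⋀^Fin (l + k)]→L[ℝ] ℝ :=
  ((k.factorial * l.factorial : ℝ)⁻¹) •
    ContinuousMultilinearMap.alternatization (insertion L α)

end Pointwise

/-! ### Brackets of vector-valued forms of low degree on a normed space -/

section Model

open VectorField

variable {F : Type*} [NormedAddCommGroup F] [NormedSpace ℝ F]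

/-- The Lie derivative `ℒ_S A = [S, A]` of a vector-valued `1`-form `A`, that is,
`(ℒ_S A)(X) = [S, A X] - A [S, X]`; see `lieEnd_apply`. -/
def lieEnd (S : F → F) (A : F → F →L[ℝ] F) (x : F) : F →L[ℝ] F :=
  fderiv ℝ A x (S x) - fderiv ℝ S x ∘L A x + A x ∘L fderiv ℝ S x

theorem lieEnd_apply {S X : F → F} {A : F → F →L[ℝ] F} {x : F} (hA : DifferentiableAt ℝ A x)
    (hX : DifferentiableAt ℝ X x) :
    lieEnd S A x (X x) =
      lieBracket ℝ S (fun y => A y (X y)) x - A x (lieBracket ℝ S X x) := by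
  simp only [lieEnd, lieBracket, fderiv_clm_apply hA hX]
  simp
  abel

/-- The Frölicher–Nijenhuis bracket `[L, K]` of two vector-valued `1`-forms, a vector-valued
`2`-form. On vector fields `X`, `Y` it is given by
`[L, K](X, Y) = [LX, KY] + [KX, LY] + (LK + KL)[X, Y]
  - L[X, KY] - L[KX, Y] - K[X, LY] - K[LX, Y]`; see `fnBracket_apply`. The definition is this
formula for constant `X`, `Y`, namely `B(X, Y) - B(Y, X)` with
`B(X, Y) = (∂_{LX} K) Y + (∂_{KX} L) Y - L ((∂_X K) Y) - K ((∂_X L) Y)`. -/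
def fnBracket (L K : F → F →L[ℝ] F) (x : F) : F [⋀^Fin 2]→L[ℝ] F :=
  ContinuousAlternatingMap.alternatizeUncurryFin
    ((ContinuousAlternatingMap.ofSubsingletonLIE (𝕜 := ℝ) (E := F) (F := F) (0 : Fin 1) :
        (F →L[ℝ] F) →L[ℝ] F [⋀^Fin 1]→L[ℝ] F) ∘L
      (fderiv ℝ K x ∘L L x + fderiv ℝ L x ∘L K x
        - ContinuousLinearMap.compL ℝ F F F (L x) ∘L fderiv ℝ K x
        - ContinuousLinearMap.compL ℝ F F F (K x) ∘L fderiv ℝ L x))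

theorem fnBracket_apply {L K : F → F →L[ℝ] F} {X Y : F → F} {x : F}
    (hL : DifferentiableAt ℝ L x) (hK : DifferentiableAt ℝ K x)
    (hX : DifferentiableAt ℝ X x) (hY : DifferentiableAt ℝ Y x) :
    fnBracket L K x ![X x, Y x] =
      lieBracket ℝ (fun y => L y (X y)) (fun y => K y (Y y)) x
      + lieBracket ℝ (fun y => K y (X y)) (fun y => L y (Y y)) x
      + L x (K x (lieBracket ℝ X Y x)) + K x (L x (lieBracket ℝ X Y x))
      - L x (lieBracket ℝ X (fun y => K y (Y y)) x)
      - L x (lieBracket ℝ (fun y => K y (X y)) Y x)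
      - K x (lieBracket ℝ X (fun y => L y (Y y)) x)
      - K x (lieBracket ℝ (fun y => L y (X y)) Y x) := by
  simp only [fnBracket, lieBracket, fderiv_clm_apply hL hX, fderiv_clm_apply hK hX,
    fderiv_clm_apply hL hY, fderiv_clm_apply hK hY,
    ContinuousAlternatingMap.alternatizeUncurryFin_apply]
  have h1 : Fin.removeNth (α := fun _ => F) 1 ![X x, Y x] 0 = X x := rfl
  simp [Fin.sum_univ_succ, h1]
  abel

end Model

/-! ### Differential forms and vector-valued forms on a manifold without boundary

As for `mfderiv` and `VectorField.mlieBracket` in Mathlib, natural differential operators are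
defined at a point `x` by their expression in the chart `extChartAt I x`. -/

section Manifold

variable {F : Type*} [NormedAddCommGroup F] [NormedSpace ℝ F] {H : Type*} [TopologicalSpace H]
  (I : ModelWithCorners ℝ F H) (N : Type*) [TopologicalSpace N] [ChartedSpace H N]

/-- Vector fields on `N`, with no regularity required. -/
abbrev VField := Π x : N, TangentSpace I x

/-- Differential `k`-forms on `N`, with no regularity required. -/
abbrev Form (k : ℕ) := Π x : N, TangentSpace I x [⋀^Fin k]→L[ℝ] ℝ

/-- Vector-valued differential `l`-forms on `N`, with no regularity required. -/
abbrev VForm (l : ℕ) := Π x : N, TangentSpace I x [⋀^Fin l]→L[ℝ] TangentSpace I x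

/-- Fields of endomorphisms of the tangent spaces, with no regularity required. -/
abbrev EndField := Π x : N, TangentSpace I x →L[ℝ] TangentSpace I x

variable {I N}

/-- A vector field, as a vector-valued `0`-form. -/
def VField.toVForm (X : VField I N) : VForm I N 0 := fun x =>
  ContinuousAlternatingMap.constOfIsEmpty ℝ (TangentSpace I x) (Fin 0) (X x)

/-- A field of endomorphisms, as a vector-valued `1`-form. -/
def EndField.toVForm (A : EndField I N) : VForm I N 1 := fun x =>
  ContinuousAlternatingMap.ofSubsingleton ℝ (TangentSpace I x) (TangentSpace I x) (0 : Fin 1) (A x)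

/-- The differential at `x` of the preferred chart at `c`. -/
def dChart (c x : N) : TangentSpace I x →L[ℝ] F :=
  mfderiv I 𝓘(ℝ, F) (extChartAt I c) x

/-- The differential at `y` of the inverse of the preferred chart at `c`. -/
def dChartSymm (c : N) (y : F) : F →L[ℝ] TangentSpace I ((extChartAt I c).symm y) :=
  mfderiv 𝓘(ℝ, F) I (extChartAt I c).symm y

/-- The coordinate expression of a vector field in the chart at `c`. -/
def VField.inChart (X : VField I N) (c : N) (y : F) : F :=
  dChart c ((extChartAt I c).symm y) (X ((extChartAt I c).symm y))

/-- The coordinate expression of a field of endomorphisms in the chart at `c`. -/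
def EndField.inChart (A : EndField I N) (c : N) (y : F) : F →L[ℝ] F :=
  dChart c ((extChartAt I c).symm y) ∘L A ((extChartAt I c).symm y) ∘L dChartSymm c y

/-- The coordinate expression of a differential form in the chart at `c`. -/
def Form.inChart {k : ℕ} (α : Form I N k) (c : N) (y : F) : F [⋀^Fin k]→L[ℝ] ℝ :=
  (α ((extChartAt I c).symm y)).compContinuousLinearMap (dChartSymm c y)

/-- The tangent vector at `x` with coordinates `w` in the chart at `x`. -/
def ofCoord (x : N) : F →L[ℝ] TangentSpace I x :=
  mfderiv 𝓘(ℝ, F) I (extChartAt I x).symm (extChartAt I x x)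

/-- The differential form `α` is smooth on a neighbourhood of `x`. -/
def Form.SmoothNear {k : ℕ} (α : Form I N k) (x : N) : Prop :=
  ∀ᶠ y in 𝓝 (extChartAt I x x), ContDiffAt ℝ ∞ (α.inChart x) y

/-- Two differential forms have the same jet of order `m` at `x`: their coordinate expressions
have the same derivatives of order `≤ m` at the point that corresponds to `x`. -/
def Form.SameJet {k : ℕ} (m : ℕ) (x : N) (α β : Form I N k) : Prop :=
  ∀ i ≤ m, iteratedFDeriv ℝ i (α.inChart x) (extChartAt I x x) =
    iteratedFDeriv ℝ i (β.inChart x) (extChartAt I x x)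

/-- The exterior derivative. -/
def extD {k : ℕ} (α : Form I N k) : Form I N (k + 1) := fun x =>
  (extDeriv (α.inChart x) (extChartAt I x x)).compContinuousLinearMap (dChart x x)

/-- The inner product `i_L α` of a form with a vector-valued form. -/
def inner {k l : ℕ} (L : VForm I N l) (α : Form I N (k + 1)) : Form I N (l + k) := fun x =>
  innerProd (L x) (α x)

/-- The exterior derivative with respect to a vector-valued `l`-form `L`:
`d_L = i_L ∘ d + (-1) ^ l d ∘ i_L`, on forms of positive degree. -/
def dWith {k l : ℕ} (L : VForm I N l) (α : Form I N (k + 1)) : Form I N (l + (k + 1)) :=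
  inner L (extD α) + (-1 : ℝ) ^ l • extD (inner L α)

/-- The Lie derivative `ℒ_S A`, `(ℒ_S A)(X) = [S, A X] - A [S, X]`. -/
def lieDeriv (S : VField I N) (A : EndField I N) : EndField I N := fun x =>
  ofCoord x ∘L lieEnd (S.inChart x) (A.inChart x) (extChartAt I x x) ∘L dChart x x

/-- The Frölicher–Nijenhuis bracket `[L, K]` of two vector-valued `1`-forms. -/
def bracket (L K : EndField I N) : VForm I N 2 := fun x =>
  (ofCoord x).compContinuousAlternatingMap
    ((fnBracket (L.inChart x) (K.inChart x) (extChartAt I x x)).compContinuousLinearMap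
      (dChart x x))

end Manifold

end FrolicherNijenhuis

/-! ### Calculus on the slashed tangent bundle -/

namespace Spray

open FrolicherNijenhuis

/-- The differential at `v` of the inclusion `w ↦ (π(v), w)` of the fibre `T_{π(v)} M` (whose
underlying vector space is the model space `E`) into the tangent bundle. -/
def fibreDeriv {E H : Type*} [NormedAddCommGroup E] [NormedSpace ℝ E] [TopologicalSpace H]
    (I : ModelWithCorners ℝ E H) {M : Type*} [TopologicalSpace M] [ChartedSpace H M]
    [IsManifold I 1 M] (v : TangentBundle I M) :
    TangentSpace I v.1 →L[ℝ] TangentSpace I.tangent v :=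
  mfderiv 𝓘(ℝ, E) I.tangent (fun w : E => (⟨v.1, w⟩ : TangentBundle I M)) v.2

variable {n : ℕ} (M : Type*) [TopologicalSpace M] [ChartedSpace (EuclideanSpace ℝ (Fin n)) M]
  [IsManifold (𝓡 n) ∞ M]

/-- The slashed tangent bundle `TM ∖ {0}`, as an open subset of `TM`. All objects below are
considered on this subset; their values on the zero section play no role. -/
def slashed : Set (TangentBundle (𝓡 n) M) := {v | v.2 ≠ 0}

/-- The differential of the projection `π : TM → M`. -/
def dProj (v : TangentBundle (𝓡 n) M) :
    TangentSpace (𝓡 n).tangent v →L[ℝ] TangentSpace (𝓡 n) v.1 :=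
  mfderiv (𝓡 n).tangent (𝓡 n) (fun w : TangentBundle (𝓡 n) M => w.1) v

/-- The vertical lift `T_{π(v)} M → T_v TM`. -/
def vertLift (v : TangentBundle (𝓡 n) M) :
    TangentSpace (𝓡 n) v.1 →L[ℝ] TangentSpace (𝓡 n).tangent v :=
  fibreDeriv (𝓡 n) v

/-- The Liouville vector field `ℂ = yⁱ ∂/∂yⁱ`. -/
def liouville : VField (𝓡 n).tangent (TangentBundle (𝓡 n) M) := fun v => vertLift M v v.2

/-- The tangent structure `J = ∂/∂yⁱ ⊗ dxⁱ`. -/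
def tangentStructure : EndField (𝓡 n).tangent (TangentBundle (𝓡 n) M) := fun v =>
  vertLift M v ∘L dProj M v

variable {M}

/-- A spray: a smooth vector field `S` on `TM ∖ {0}` with `J S = ℂ` and `[ℂ, S] = S`. -/
structure IsSpray (S : VField (𝓡 n).tangent (TangentBundle (𝓡 n) M)) : Prop where
  smooth : ContMDiffOn (𝓡 n).tangent (𝓡 n).tangent.tangent ∞
    (fun v => (⟨v, S v⟩ : TangentBundle (𝓡 n).tangent (TangentBundle (𝓡 n) M))) (slashed M)
  secondOrder : ∀ v ∈ slashed M, tangentStructure M v (S v) = liouville M v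
  homogeneous : ∀ v ∈ slashed M,
    VectorField.mlieBracket (𝓡 n).tangent (liouville M) S v = S v

/-- The horizontal projector `h = (Id - ℒ_S J) / 2` of the nonlinear connection induced
by `S`. -/
def horizontal (S : VField (𝓡 n).tangent (TangentBundle (𝓡 n) M)) :
    EndField (𝓡 n).tangent (TangentBundle (𝓡 n) M) := fun v =>
  (1 / 2 : ℝ) • (ContinuousLinearMap.id ℝ _ - lieDeriv S (tangentStructure M) v)

/-- The curvature tensor `R = [h, h] / 2` of the nonlinear connection induced by `S`. -/
def curvature (S : VField (𝓡 n).tangent (TangentBundle (𝓡 n) M)) :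
    VForm (𝓡 n).tangent (TangentBundle (𝓡 n) M) 2 :=
  (1 / 2 : ℝ) • bracket (horizontal S) (horizontal S)

/-- A `1`-form is semi-basic at `v` if it vanishes on the vertical vectors at `v`. -/
def IsSemibasicAt (θ : Form (𝓡 n).tangent (TangentBundle (𝓡 n) M) 1)
    (v : TangentBundle (𝓡 n) M) : Prop :=
  ∀ ξ : TangentSpace (𝓡 n).tangent v, dProj M v ξ = 0 → θ v ![ξ] = 0

/-- Local sections of `T*_v` near `u`: smooth semi-basic `1`-forms defined near `u`. -/
def LocalSection (u : TangentBundle (𝓡 n) M) :=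
  {θ : Form (𝓡 n).tangent (TangentBundle (𝓡 n) M) 1 //
    θ.SmoothNear u ∧ ∀ᶠ v in 𝓝 u, IsSemibasicAt θ v}

/-- `ℒ_ℂ θ`. Since `ℂ` is a vector-valued `0`-form, `ℒ_ℂ = d_ℂ = i_ℂ d + d i_ℂ`. -/
def lieLiouville (θ : Form (𝓡 n).tangent (TangentBundle (𝓡 n) M) 1) :
    Form (𝓡 n).tangent (TangentBundle (𝓡 n) M) 1 :=
  dWith (k := 0) (l := 0) (liouville M).toVForm θ

/-- `d_J θ`. -/
def dJ (θ : Form (𝓡 n).tangent (TangentBundle (𝓡 n) M) 1) :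
    Form (𝓡 n).tangent (TangentBundle (𝓡 n) M) 2 :=
  dWith (k := 0) (l := 1) (tangentStructure M).toVForm θ

/-- `d_h θ`. -/
def dh (S : VField (𝓡 n).tangent (TangentBundle (𝓡 n) M))
    (θ : Form (𝓡 n).tangent (TangentBundle (𝓡 n) M) 1) :
    Form (𝓡 n).tangent (TangentBundle (𝓡 n) M) 2 :=
  dWith (k := 0) (l := 1) (horizontal S).toVForm θ

/-- `d_R θ`. -/
def dR (S : VField (𝓡 n).tangent (TangentBundle (𝓡 n) M))
    (θ : Form (𝓡 n).tangent (TangentBundle (𝓡 n) M) 1) :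
    Form (𝓡 n).tangent (TangentBundle (𝓡 n) M) 3 :=
  dWith (k := 0) (l := 2) (curvature S) θ

/-- The jet of order `m` at `u` of `P₁ θ = (ℒ_ℂ θ, d_J θ, d_h θ)` is zero. -/
def JetP1Vanishes (S : VField (𝓡 n).tangent (TangentBundle (𝓡 n) M)) (m : ℕ)
    (u : TangentBundle (𝓡 n) M) (θ : Form (𝓡 n).tangent (TangentBundle (𝓡 n) M) 1) : Prop :=
  (lieLiouville θ).SameJet m u 0 ∧ (dJ θ).SameJet m u 0 ∧ (dh S θ).SameJet m u 0

/-- The equivalence relation "same jet of order `k` at `u`" on local sections of `T*_v`. -/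
def jetSetoid (k : ℕ) (u : TangentBundle (𝓡 n) M) : Setoid (LocalSection u) where
  r θ θ' := Form.SameJet k u θ.1 θ'.1
  iseqv :=
    ⟨fun _ _ _ => rfl, fun h i hi => (h i hi).symm, fun h h' i hi => (h i hi).trans (h' i hi)⟩

/-- The fibre `J^k_u T*_v` at `u` of the bundle of jets of order `k`. -/
def JetSpace (k : ℕ) (u : TangentBundle (𝓡 n) M) := Quotient (jetSetoid k u)

/-- The jet `j^k_u θ`. -/
def jet (k : ℕ) {u : TangentBundle (𝓡 n) M} (θ : LocalSection u) : JetSpace k u :=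
  Quotient.mk (jetSetoid k u) θ

/-- The projection `J^{k+1}_u T*_v → J^k_u T*_v`. -/
def jetProj (k : ℕ) (u : TangentBundle (𝓡 n) M) : JetSpace (k + 1) u → JetSpace k u :=
  Quotient.map' (s₁ := jetSetoid (k + 1) u) (s₂ := jetSetoid k u) id
    fun _ _ h i hi => h i (hi.trans (Nat.le_succ k))

/-- The space `R^{1+l}_u(P₁) = Ker p^l_u(P₁) ⊂ J^{1+l}_u T*_v` of formal solutions of order
`1 + l` at `u`, where `p^l_u(P₁)` sends `j^{1+l}_u θ` to `j^l_u (P₁ θ)`. -/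
def FormalSolution (S : VField (𝓡 n).tangent (TangentBundle (𝓡 n) M)) (l : ℕ)
    (u : TangentBundle (𝓡 n) M) : Set (JetSpace (l + 1) u) :=
  {j | ∃ θ : LocalSection u, jet (l + 1) θ = j ∧ JetP1Vanishes S l u θ.1}

theorem jetProj_mem {S : VField (𝓡 n).tangent (TangentBundle (𝓡 n) M)} {l : ℕ}
    {u : TangentBundle (𝓡 n) M} {j : JetSpace (l + 1 + 1) u} (hj : j ∈ FormalSolution S (l + 1) u) :
    jetProj (l + 1) u j ∈ FormalSolution S l u := by
  obtain ⟨θ, rfl, h1, h2, h3⟩ := hj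
  exact ⟨θ, rfl, fun i hi => h1 i (hi.trans (Nat.le_succ l)),
    fun i hi => h2 i (hi.trans (Nat.le_succ l)), fun i hi => h3 i (hi.trans (Nat.le_succ l))⟩

/-- The restriction `R^{l+2}_u(P₁) → R^{l+1}_u(P₁)` of the projection of jets. -/
def solutionProj (S : VField (𝓡 n).tangent (TangentBundle (𝓡 n) M)) (l : ℕ)
    (u : TangentBundle (𝓡 n) M) (j : FormalSolution S (l + 1) u) : FormalSolution S l u :=
  ⟨jetProj (l + 1) u j.1, jetProj_mem j.2⟩

end Spray

end

noncomputable section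

namespace FrolicherNijenhuis

/-! In the chart at `u` a semi-basic form is `θ = t_i dxⁱ`, the spray is `(y, A)`, and horizontal
vectors are the pairs `(a, m a)` with `m = ½ ∂_y A`. Let `T` and `U` be the first and second
derivatives of `t` at `u`, and `K` that of `m`. Then `P₁ θ = 0` at `u` says that `T (0, y) = 0` and
that `T (0, a) b` and `T (a, m a) b` are symmetric in `a`, `b` (`FirstOrder`). The vanishing of the
1-jet adds the derivatives of these equations, which are affine in `U` (`SecondOrder`). These
dictionaries are `jetP1Vanishes_zero_iff` and `jetP1Vanishes_one_iff`. Since `R` has vertical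
values, `(d_R θ)_u` is a cyclic sum of terms `T (0, R (a, b)) c`, so its vanishing is the condition
`Integrable` on `T`, `m`, `K` alone.

The theorem thus becomes linear algebra: given `T` satisfying `FirstOrder`, a symmetric `U`
satisfying `SecondOrder` exists iff `T` is `Integrable`. Necessity (`SecondOrder.integrable`): in
the cyclic sum of the differentiated horizontal equations along horizontal vectors, `U` cancels by
symmetry and only curvature terms remain. Sufficiency (`Integrable.exists_secondOrder`): `U` is
written down block by block along the splitting into horizontal and vertical vectors. The vertical
and mixed blocks can always be solved, because a spray connection is homogeneous and torsion-free;
the horizontal block is solvable exactly under the cyclic condition. Any symmetric `U` is the second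
derivative of a section with the given 1-jet (`LocalSection.exists_sameJet_one`).

The remaining work is coordinate calculus. Each operator is defined at a point in the chart of that
same point, whereas a jet at `u` needs its values near `u` in the single chart at `u`; hence the
naturality results `extD_eq` and `dChart_lieDeriv`. -/

theorem two_le_infty : (2 : ℕ∞ω) ≤ ∞ := WithTop.coe_le_coe.2 (le_top : (2 : ℕ∞) ≤ ⊤)

/-! ### Coordinate expressions and changes of chart. -/

section Naturality

variable {F : Type*} [NormedAddCommGroup F] [NormedSpace ℝ F] {H : Type*} [TopologicalSpace H]
  {I : ModelWithCorners ℝ F H} {N : Type*} [TopologicalSpace N]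
  [ChartedSpace H N]

theorem VField.inChart_extChartAt (X : VField I N) {c x : N} (hx : x ∈ (extChartAt I c).source) :
    X.inChart c (extChartAt I c x) = dChart c x (X x) := by
  obtain ⟨y, hy, rfl⟩ : ∃ y ∈ (extChartAt I c).target, (extChartAt I c).symm y = x :=
    ⟨_, (extChartAt I c).map_source hx, (extChartAt I c).left_inv hx⟩
  rw [(extChartAt I c).right_inv hy]
  rfl

/-- The transition map from the chart at `b` to the chart at `c`. -/
def transition (I : ModelWithCorners ℝ F H) {N : Type*} [TopologicalSpace N] [ChartedSpace H N]
    (c b : N) : F → F :=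
  extChartAt I c ∘ (extChartAt I b).symm

theorem transition_extChartAt (c b : N) :
    transition I c b (extChartAt I b b) = extChartAt I c b := by
  simp [transition]

variable [I.Boundaryless] [IsManifold I ∞ N]

theorem dChart_dChartSymm {c : N} {y : F} (hy : y ∈ (extChartAt I c).target) (w : F) :
    dChart c ((extChartAt I c).symm y) (dChartSymm (I := I) c y w) = w := by
  have : IsManifold I 1 N := .of_le (n := ∞) (by simp)
  have h := mfderiv_extChartAt_comp_mfderivWithin_extChartAt_symm (I := I) hy
  rw [I.range_eq_univ, mfderivWithin_univ] at h
  exact DFunLike.congr_fun h w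

theorem dChartSymm_dChart {c : N} {y : F} (hy : y ∈ (extChartAt I c).target)
    (ξ : TangentSpace I ((extChartAt I c).symm y)) :
    dChartSymm (I := I) c y (dChart c ((extChartAt I c).symm y) ξ) = ξ := by
  have : IsManifold I 1 N := .of_le (n := ∞) (by simp)
  have h := mfderivWithin_extChartAt_symm_comp_mfderiv_extChartAt (I := I) hy
  rw [I.range_eq_univ, mfderivWithin_univ] at h
  exact DFunLike.congr_fun h ξ

theorem dChart_injective {c x : N} (hx : x ∈ (extChartAt I c).source) :
    Function.Injective (dChart (I := I) c x) := by
  obtain ⟨y, hy, rfl⟩ : ∃ y ∈ (extChartAt I c).target, (extChartAt I c).symm y = x :=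
    ⟨_, (extChartAt I c).map_source hx, (extChartAt I c).left_inv hx⟩
  exact Function.LeftInverse.injective (dChartSymm_dChart hy)

theorem dChart_surjective {c x : N} (hx : x ∈ (extChartAt I c).source) :
    Function.Surjective (dChart (I := I) c x) := by
  obtain ⟨y, hy, rfl⟩ : ∃ y ∈ (extChartAt I c).target, (extChartAt I c).symm y = x :=
    ⟨_, (extChartAt I c).map_source hx, (extChartAt I c).left_inv hx⟩
  exact Function.RightInverse.surjective (dChart_dChartSymm hy)

theorem dChart_ofCoord (x : N) (w : F) : dChart x x (ofCoord (I := I) x w) = w := by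
  have : IsManifold I 1 N := .of_le (n := ∞) (by simp)
  have h := mfderiv_extChartAt_comp_mfderivWithin_extChartAt_symm' (I := I)
    (mem_extChartAt_source (I := I) x)
  rw [I.range_eq_univ, mfderivWithin_univ] at h
  exact DFunLike.congr_fun h w

theorem EndField.inChart_extChartAt (A : EndField I N) {c x : N}
    (hx : x ∈ (extChartAt I c).source) (ξ : TangentSpace I x) :
    A.inChart c (extChartAt I c x) (dChart c x ξ) = dChart c x (A x ξ) := by
  obtain ⟨y, hy, rfl⟩ : ∃ y ∈ (extChartAt I c).target, (extChartAt I c).symm y = x :=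
    ⟨_, (extChartAt I c).map_source hx, (extChartAt I c).left_inv hx⟩
  rw [(extChartAt I c).right_inv hy]
  change dChart c _ (A _ (dChartSymm c y (dChart c _ ξ))) = _
  rw [dChartSymm_dChart hy]

theorem Form.inChart_extChartAt {k : ℕ} (α : Form I N k) {c x : N}
    (hx : x ∈ (extChartAt I c).source) :
    (α.inChart c (extChartAt I c x)).compContinuousLinearMap (dChart c x) = α x := by
  obtain ⟨y, hy, rfl⟩ : ∃ y ∈ (extChartAt I c).target, (extChartAt I c).symm y = x :=
    ⟨_, (extChartAt I c).map_source hx, (extChartAt I c).left_inv hx⟩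
  rw [(extChartAt I c).right_inv hy]
  ext v
  change α _ (fun i => dChartSymm c y (dChart c _ (v i))) = _
  simp only [dChartSymm_dChart hy]

theorem Form.inChart_eq {k : ℕ} {α : Form I N k} {c : N} {y : F}
    (hy : y ∈ (extChartAt I c).target) {β : F [⋀^Fin k]→L[ℝ] ℝ}
    (h : α ((extChartAt I c).symm y) =
      β.compContinuousLinearMap (dChart c ((extChartAt I c).symm y))) :
    α.inChart c y = β := by
  ext v
  change α _ (fun i => dChartSymm c y (v i)) = _
  rw [h]
  change β (fun i => dChart c _ (dChartSymm c y (v i))) = _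
  simp only [dChart_dChartSymm hy]

theorem EndField.inChart_eq {A : EndField I N} {c : N} {y : F}
    (hy : y ∈ (extChartAt I c).target) {B : F →L[ℝ] F}
    (h : ∀ ξ, dChart c _ (A ((extChartAt I c).symm y) ξ) =
      B (dChart c ((extChartAt I c).symm y) ξ)) :
    A.inChart c y = B := by
  ext v
  change dChart c _ (A _ (dChartSymm c y v)) = _
  rw [h, dChart_dChartSymm hy]

theorem contDiffAt_transition {c b : N} (hb : b ∈ (extChartAt I c).source) :
    ContDiffAt ℝ ∞ (transition I c b) (extChartAt I b b) := by
  have := contDiffWithinAt_ext_coord_change (I := I) (n := ∞) c b (y := extChartAt I b b) (by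
    simp only [PartialEquiv.trans_source, PartialEquiv.symm_source, Set.mem_inter_iff,
      Set.mem_preimage, extChartAt_to_inv]
    exact ⟨mem_extChartAt_target b, hb⟩)
  rwa [I.range_eq_univ, contDiffWithinAt_univ] at this

omit [IsManifold I ∞ N] in
theorem eventually_mem_target_inter (b : N) {U : Set N} (hU : U ∈ 𝓝 b) :
    ∀ᶠ y in 𝓝 (extChartAt I b b), y ∈ (extChartAt I b).target ∧ (extChartAt I b).symm y ∈ U := by
  refine Filter.Eventually.and (extChartAt_target_mem_nhds (I := I) b) ?_
  apply (continuousAt_extChartAt_symm (I := I) b).eventually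
  rw [extChartAt_to_inv]
  exact hU

/-- Chain rule for the transition map: this turns manifold derivatives into ordinary Fréchet
derivatives. -/
theorem dChart_dChartSymm_eq_fderiv {c b : N} {y : F} (hy : y ∈ (extChartAt I b).target)
    (hc : (extChartAt I b).symm y ∈ (extChartAt I c).source) (w : F) :
    dChart c ((extChartAt I b).symm y) (dChartSymm (I := I) b y w) =
      fderiv ℝ (transition I c b) y w := by
  have : IsManifold I 1 N := .of_le (n := ∞) (by simp)
  have h1 : MDifferentiableAt I 𝓘(ℝ, F) (extChartAt I c) ((extChartAt I b).symm y) :=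
    mdifferentiableAt_extChartAt (by rwa [← extChartAt_source (I := I)])
  have h2 : MDifferentiableAt 𝓘(ℝ, F) I (extChartAt I b).symm y := by
    have := mdifferentiableWithinAt_extChartAt_symm (I := I) hy
    rwa [I.range_eq_univ, mdifferentiableWithinAt_univ] at this
  have h3 := mfderiv_comp y h1 h2
  rw [mfderiv_eq_fderiv] at h3
  exact (DFunLike.congr_fun h3 w).symm

theorem dChart_ofCoord_eq_fderiv {c b : N} (hb : b ∈ (extChartAt I c).source) (w : F) :
    dChart c b (ofCoord (I := I) b w) = fderiv ℝ (transition I c b) (extChartAt I b b) w := by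
  have : IsManifold I 1 N := .of_le (n := ∞) (by simp)
  have h1 : HasMFDerivAt I 𝓘(ℝ, F) (extChartAt I c) ((extChartAt I b).symm (extChartAt I b b))
      (dChart (I := I) c b : F →L[ℝ] F) := by
    rw [extChartAt_to_inv]
    exact (mdifferentiableAt_extChartAt (by rwa [← extChartAt_source (I := I)])).hasMFDerivAt
  have h2 : MDifferentiableAt 𝓘(ℝ, F) I (extChartAt I b).symm (extChartAt I b b) := by
    have := mdifferentiableWithinAt_extChartAt_symm (I := I) (mem_extChartAt_target (I := I) b)
    rwa [I.range_eq_univ, mdifferentiableWithinAt_univ] at this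
  have h3 := (h1.comp (extChartAt I b b) h2.hasMFDerivAt).mfderiv
  rw [mfderiv_eq_fderiv] at h3
  exact (DFunLike.congr_fun h3 w).symm

/-! ### Exterior derivative and Lie derivative in an arbitrary chart -/

theorem Form.inChart_transition {k : ℕ} (α : Form I N k) {c b : N}
    (hb : b ∈ (extChartAt I c).source) :
    α.inChart b =ᶠ[𝓝 (extChartAt I b b)] fun y =>
      (α.inChart c (transition I c b y)).compContinuousLinearMap
        (fderiv ℝ (transition I c b) y) := by
  filter_upwards [eventually_mem_target_inter (I := I) b
    ((isOpen_extChartAt_source c).mem_nhds hb)] with y hy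
  ext v
  change α _ (fun i => dChartSymm b y (v i)) = α.inChart c _ (fun i => fderiv ℝ _ y (v i))
  rw [← α.inChart_extChartAt hy.2]
  simp only [← dChart_dChartSymm_eq_fderiv hy.1 hy.2]
  rfl

/-- The exterior derivative commutes with pullback along the transition map, so `extD` at `b` may be
computed in any chart around `b`, not only in the preferred one. -/
theorem extD_eq {k : ℕ} {α : Form I N k} {c b : N} (hb : b ∈ (extChartAt I c).source)
    (hα : DifferentiableAt ℝ (α.inChart c) (extChartAt I c b)) :
    extD α b =
      (extDeriv (α.inChart c) (extChartAt I c b)).compContinuousLinearMap (dChart c b) := by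
  have h1 := (α.inChart_transition hb).extDeriv_eq
  rw [extDeriv_pullback (r := 2) (by rwa [transition_extChartAt])
    ((contDiffAt_transition hb).of_le two_le_infty) (by simp), transition_extChartAt] at h1
  ext v
  change extDeriv (α.inChart b) _ (fun i => dChart b b (v i)) =
    extDeriv _ _ (fun i => dChart c b (v i))
  rw [h1]
  change extDeriv _ _ (fun i => fderiv ℝ _ _ (dChart b b (v i))) = _
  congr 1
  funext i
  rw [← dChart_ofCoord_eq_fderiv hb]
  congr 1
  -- `ofCoord b` is a right inverse of `dChart b b`; injectivity makes it a left inverse too.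
  exact dChart_injective (mem_extChartAt_source b) (dChart_ofCoord _ _)

omit [IsManifold I ∞ N] in
theorem extD_congr {k : ℕ} {α β : Form I N k} {b : N} (h : ∀ᶠ x in 𝓝 b, α x = β x) :
    extD α b = extD β b := by
  have : α.inChart b =ᶠ[𝓝 (extChartAt I b b)] β.inChart b := by
    filter_upwards [eventually_mem_target_inter (I := I) b h] with y hy
    have := hy.2
    change α _ = β _ at this
    simp only [Form.inChart, this]
  simp only [extD, this.extDeriv_eq]

omit [IsManifold I ∞ N] in
theorem extD_eq_zero {k : ℕ} {α : Form I N k} {b : N} (h : ∀ᶠ x in 𝓝 b, α x = 0) :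
    extD α b = 0 := by
  rw [extD_congr (β := 0) h]
  have : (0 : Form I N k).inChart b = fun _ => 0 := rfl
  ext v
  change ContinuousAlternatingMap.alternatizeUncurryFin (fderiv ℝ ((0 : Form I N k).inChart b) _)
    (fun i => dChart b b (v i)) = 0
  rw [this, ContinuousAlternatingMap.alternatizeUncurryFin_apply]
  simp

/-- If `S`, `S'` and `A`, `A'` are `φ`-related near `y`, so are the Lie derivatives. Differentiating
the two relations produces terms in the second derivative of `φ`, which cancel by its symmetry. -/
theorem lieEnd_map {φ S S' : F → F} {A A' : F → F →L[ℝ] F} {y : F}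
    (hφ : ContDiffAt ℝ 2 φ y)
    (hS : (fun z => S' (φ z)) =ᶠ[𝓝 y] fun z => fderiv ℝ φ z (S z))
    (hA : (fun z => A' (φ z) ∘L fderiv ℝ φ z) =ᶠ[𝓝 y] fun z => fderiv ℝ φ z ∘L A z)
    (dS : DifferentiableAt ℝ S y) (dA : DifferentiableAt ℝ A y)
    (dS' : DifferentiableAt ℝ S' (φ y)) (dA' : DifferentiableAt ℝ A' (φ y)) (w : F) :
    lieEnd S' A' (φ y) (fderiv ℝ φ y w) = fderiv ℝ φ y (lieEnd S A y w) := by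
  have dφ : DifferentiableAt ℝ φ y := hφ.differentiableAt (by simp)
  have ddφ : DifferentiableAt ℝ (fderiv ℝ φ) y :=
    (hφ.fderiv_right (m := 1) (by norm_num)).differentiableAt (by simp)
  have hsymm : IsSymmSndFDerivAt ℝ φ y := hφ.isSymmSndFDerivAt (by simp)
  have hS' : ∀ v, fderiv ℝ S' (φ y) (fderiv ℝ φ y v) =
      fderiv ℝ φ y (fderiv ℝ S y v) + fderiv ℝ (fderiv ℝ φ) y v (S y) := by
    intro v
    have h := DFunLike.congr_fun (hS.fderiv_eq (𝕜 := ℝ)) v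
    rw [fderiv_fun_comp (g := S') y dS' dφ, fderiv_clm_apply ddφ dS] at h
    simpa using h
  have hA' : ∀ v x, fderiv ℝ A' (φ y) (fderiv ℝ φ y v) (fderiv ℝ φ y x) +
      A' (φ y) (fderiv ℝ (fderiv ℝ φ) y v x) =
      fderiv ℝ φ y (fderiv ℝ A y v x) + fderiv ℝ (fderiv ℝ φ) y v (A y x) := by
    intro v x
    have h := DFunLike.congr_fun (DFunLike.congr_fun (hA.fderiv_eq (𝕜 := ℝ)) v) x
    have d1 : DifferentiableAt ℝ (fun z => A' (φ z)) y := DifferentiableAt.comp y (g := A') dA' dφ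
    rw [fderiv_clm_comp d1 ddφ, fderiv_clm_comp ddφ dA, fderiv_fun_comp (g := A') y dA' dφ] at h
    simp at h
    rw [add_comm, h]
  have e1 : S' (φ y) = fderiv ℝ φ y (S y) := hS.self_of_nhds
  have e2 : ∀ x, A' (φ y) (fderiv ℝ φ y x) = fderiv ℝ φ y (A y x) := fun x =>
    DFunLike.congr_fun hA.self_of_nhds x
  have h1 := hA' (S y) w
  have h2 := hS' (A y w)
  have h3 := hS' w
  simp only [lieEnd, add_apply, sub_apply,
    ContinuousLinearMap.comp_apply, map_add, map_sub, e1, e2, h2, h3]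
  rw [hsymm.eq w (S y), hsymm.eq (A y w) (S y), eq_sub_of_add_eq h1]
  abel

theorem dChart_lieDeriv {S : VField I N} {A : EndField I N} {c b : N}
    (hb : b ∈ (extChartAt I c).source)
    (dS : DifferentiableAt ℝ (S.inChart b) (extChartAt I b b))
    (dA : DifferentiableAt ℝ (A.inChart b) (extChartAt I b b))
    (dS' : DifferentiableAt ℝ (S.inChart c) (extChartAt I c b))
    (dA' : DifferentiableAt ℝ (A.inChart c) (extChartAt I c b)) (ξ : TangentSpace I b) :
    dChart c b (lieDeriv S A b ξ) =
      lieEnd (S.inChart c) (A.inChart c) (extChartAt I c b) (dChart c b ξ) := by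
  -- Relatedness under the transition map is needed on a neighbourhood, since it is differentiated
  -- in `lieEnd_map`.
  have hnear := eventually_mem_target_inter (I := I) b ((isOpen_extChartAt_source c).mem_nhds hb)
  have key := lieEnd_map (φ := transition I c b) (S := S.inChart b) (S' := S.inChart c)
    (A := A.inChart b) (A' := A.inChart c) (y := extChartAt I b b)
    ((contDiffAt_transition hb).of_le two_le_infty) ?_ ?_ dS dA
    (by rwa [transition_extChartAt]) (by rwa [transition_extChartAt]) (dChart b b ξ)
  · change dChart c b (ofCoord b _) = _
    rw [dChart_ofCoord_eq_fderiv hb]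
    refine key.symm.trans ?_
    rw [transition_extChartAt, ← dChart_ofCoord_eq_fderiv hb]
    congr 2
    exact dChart_injective (mem_extChartAt_source b) (dChart_ofCoord _ _)
  · filter_upwards [hnear] with y hy
    change S.inChart c (extChartAt I c _) = _
    rw [S.inChart_extChartAt hy.2, ← dChart_dChartSymm_eq_fderiv hy.1 hy.2]
    change _ = dChart c _ (dChartSymm b y (dChart b _ _))
    rw [dChartSymm_dChart hy.1]
  · filter_upwards [hnear] with y hy
    ext w
    change A.inChart c (extChartAt I c _) (fderiv ℝ _ y w) = fderiv ℝ _ y (A.inChart b y w)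
    rw [← dChart_dChartSymm_eq_fderiv hy.1 hy.2, ← dChart_dChartSymm_eq_fderiv hy.1 hy.2,
      A.inChart_extChartAt hy.2]
    change _ = dChart c _ (dChartSymm b y (dChart b _ _))
    rw [dChartSymm_dChart hy.1]
    rfl

/-! ### Inner products and linear isomorphisms -/

end Naturality

end FrolicherNijenhuis

namespace FrolicherNijenhuis

/-! ### Explicit inner products in low degree. -/

section InnerProd

variable {V W : Type*} [AddCommGroup V] [Module ℝ V] [TopologicalSpace V]
  [AddCommGroup W] [Module ℝ W] [TopologicalSpace W]

theorem innerProd_apply {k l : ℕ} (L : V [⋀^Fin l]→L[ℝ] V) (α : V [⋀^Fin (k + 1)]→L[ℝ] ℝ)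
    (v : Fin (l + k) → V) :
    innerProd L α v = (k.factorial * l.factorial : ℝ)⁻¹ * ∑ σ : Equiv.Perm (Fin (l + k)),
      ((Equiv.Perm.sign σ : ℤ) : ℝ) * α (Fin.cons (L fun i => v (σ (Fin.castAdd k i)))
        fun j => v (σ (Fin.natAdd l j))) := by
  simp only [innerProd, ContinuousAlternatingMap.smul_apply, smul_eq_mul]
  congr 1
  rw [ContinuousMultilinearMap.alternatization_apply_apply]
  refine Finset.sum_congr rfl fun σ _ => ?_
  rw [Units.smul_def, zsmul_eq_mul]
  rfl

theorem innerProd_compContinuousLinearMap {k l : ℕ} {L : V [⋀^Fin l]→L[ℝ] V}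
    {L' : W [⋀^Fin l]→L[ℝ] W} {D : V →L[ℝ] W} (h : ∀ v, D (L v) = L' fun i => D (v i))
    (α : W [⋀^Fin (k + 1)]→L[ℝ] ℝ) :
    innerProd L (α.compContinuousLinearMap D) = (innerProd L' α).compContinuousLinearMap D := by
  ext v
  rw [innerProd_apply]
  change _ = innerProd L' α (fun i => D (v i))
  rw [innerProd_apply]
  congr 1
  refine Finset.sum_congr rfl fun σ _ => ?_
  congr 1
  change α (fun i => D _) = _
  congr 1
  funext i
  refine Fin.cases ?_ (fun j => ?_) i
  · simp only [Fin.cons_zero, h]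
  · simp only [Fin.cons_succ]

theorem innerProd_eq_zero {k l : ℕ} {L : V [⋀^Fin l]→L[ℝ] V} {α : V [⋀^Fin (k + 1)]→L[ℝ] ℝ}
    (h : ∀ v w, α (Fin.cons (L v) w) = 0) : innerProd L α = 0 := by
  ext v
  simp [innerProd_apply, h]

theorem innerProd_constOfIsEmpty (w : V) (α : V [⋀^Fin 2]→L[ℝ] ℝ) (x : V) :
    innerProd (k := 1) (l := 0) (ContinuousAlternatingMap.constOfIsEmpty ℝ V (Fin 0) w) α ![x] =
      α ![w, x] := by
  rw [innerProd_apply]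
  have : (Finset.univ : Finset (Equiv.Perm (Fin (0 + 1)))) = {1} := by decide
  rw [this, Finset.sum_singleton]
  simp
  congr 1
  funext i
  fin_cases i <;> rfl

theorem innerProd_ofSubsingleton (A : V →L[ℝ] V) (α : V [⋀^Fin 1]→L[ℝ] ℝ) (x : V) :
    innerProd (k := 0) (l := 1) (ContinuousAlternatingMap.ofSubsingleton ℝ V V (0 : Fin 1) A) α
      ![x] = α ![A x] := by
  rw [innerProd_apply]
  have : (Finset.univ : Finset (Equiv.Perm (Fin (1 + 0)))) = {1} := by decide
  rw [this, Finset.sum_singleton]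
  simp
  congr 1
  funext i
  fin_cases i; rfl

theorem innerProd_ofSubsingleton_two (A : V →L[ℝ] V) (α : V [⋀^Fin 2]→L[ℝ] ℝ) (x y : V) :
    innerProd (k := 1) (l := 1) (ContinuousAlternatingMap.ofSubsingleton ℝ V V (0 : Fin 1) A) α
      ![x, y] = α ![A x, y] - α ![A y, x] := by
  rw [innerProd_apply]
  have : (Finset.univ : Finset (Equiv.Perm (Fin (1 + 1)))) = {1, Equiv.swap 0 1} := by decide
  rw [this, Finset.sum_pair (by decide)]
  simp [sub_eq_add_neg]
  congr 2
  all_goals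
    congr 1
    funext i
    fin_cases i <;> rfl

/-- The six permutations pair up under exchange of the two arguments of `L`. Each pair gives the
same term twice, which absorbs the factor `1 / 2!`. -/
theorem innerProd_two_two (L : V [⋀^Fin 2]→L[ℝ] V) (α : V [⋀^Fin 2]→L[ℝ] ℝ) (x y z : V) :
    innerProd (k := 1) (l := 2) L α ![x, y, z] =
      α ![L ![x, y], z] + α ![L ![y, z], x] + α ![L ![z, x], y] := by
  rw [innerProd_apply]
  have hu : (Finset.univ : Finset (Equiv.Perm (Fin (2 + 1)))) =
      {1, Equiv.swap 0 1, Equiv.swap 0 2, Equiv.swap 1 2, Equiv.swap 0 1 * Equiv.swap 1 2,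
        Equiv.swap 0 2 * Equiv.swap 1 2} := by decide
  have s1 : Equiv.Perm.sign (1 : Equiv.Perm (Fin (2 + 1))) = 1 := by decide
  have s2 : Equiv.Perm.sign (Equiv.swap 0 1 : Equiv.Perm (Fin (2 + 1))) = -1 := by decide
  have s3 : Equiv.Perm.sign (Equiv.swap 0 2 : Equiv.Perm (Fin (2 + 1))) = -1 := by decide
  have s4 : Equiv.Perm.sign (Equiv.swap 1 2 : Equiv.Perm (Fin (2 + 1))) = -1 := by decide
  have s5 : Equiv.Perm.sign (Equiv.swap 0 1 * Equiv.swap 1 2 : Equiv.Perm (Fin (2 + 1))) = 1 := by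
    decide
  have s6 : Equiv.Perm.sign (Equiv.swap 0 2 * Equiv.swap 1 2 : Equiv.Perm (Fin (2 + 1))) = 1 := by
    decide
  have hcons : ∀ (σ : Equiv.Perm (Fin (2 + 1))), α (Fin.cons
      (L fun i => (![x, y, z] : Fin 3 → V) (σ (Fin.castAdd 1 i)))
        fun j => (![x, y, z] : Fin 3 → V) (σ (Fin.natAdd 2 j))) =
      α ![L ![(![x, y, z] : Fin 3 → V) (σ 0), (![x, y, z] : Fin 3 → V) (σ 1)],
        (![x, y, z] : Fin 3 → V) (σ 2)] := by
    intro σ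
    congr 1
    funext i
    fin_cases i
    · change L _ = L _
      congr 1
      funext i
      fin_cases i <;> rfl
    · rfl
  have hsw : ∀ a b, L ![a, b] = - L ![b, a] := by
    intro a b
    have := L.map_swap ![b, a] (i := 0) (j := 1) (by decide)
    refine Eq.trans ?_ this
    change L _ = L _
    congr 1
    funext i
    fin_cases i <;> rfl
  have hneg : ∀ a b, α ![-a, b] = - α ![a, b] := by
    intro a b
    have := α.cons_smul ![b] (-1 : ℝ) a
    simpa using this
  rw [hu, Finset.sum_insert (by decide), Finset.sum_insert (by decide),
    Finset.sum_insert (by decide), Finset.sum_insert (by decide), Finset.sum_pair (by decide),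
    s1, s2, s3, s4, s5, s6]
  simp only [hcons]
  change _ * (_ * α ![L ![x, y], z] + (_ * α ![L ![y, x], z] + (_ * α ![L ![z, y], x] +
    (_ * α ![L ![x, z], y] + (_ * α ![L ![y, z], x] + _ * α ![L ![z, x], y]))))) = _
  rw [hsw y x, hsw z y, hsw x z, hneg, hneg, hneg]
  simp [Nat.factorial]
  ring

end InnerProd

/-! ### Forms of low degree on a normed space -/

section LowDegree

variable {F : Type*} [NormedAddCommGroup F] [NormedSpace ℝ F]

/-- A covector, as a `1`-form. -/
def oneForm : (F →L[ℝ] ℝ) →L[ℝ] F [⋀^Fin 1]→L[ℝ] ℝ :=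
  (ContinuousAlternatingMap.ofSubsingletonLIE (𝕜 := ℝ) (E := F) (F := ℝ) (0 : Fin 1) :
    (F →L[ℝ] ℝ) →L[ℝ] F [⋀^Fin 1]→L[ℝ] ℝ)

@[simp]
theorem oneForm_apply (f : F →L[ℝ] ℝ) (v : Fin 1 → F) : oneForm f v = f (v 0) := rfl

/-- The `2`-form `(X, Y) ↦ b (X, Y) - b (Y, X)`. -/
def skewForm : (F →L[ℝ] F →L[ℝ] ℝ) →L[ℝ] F [⋀^Fin 2]→L[ℝ] ℝ :=
  ContinuousAlternatingMap.alternatizeUncurryFinCLM ℝ F ℝ ∘L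
    ContinuousLinearMap.compL ℝ F (F →L[ℝ] ℝ) (F [⋀^Fin 1]→L[ℝ] ℝ) oneForm

@[simp]
theorem skewForm_apply (b : F →L[ℝ] F →L[ℝ] ℝ) (X Y : F) :
    skewForm b ![X, Y] = b X Y - b Y X := by
  change ContinuousAlternatingMap.alternatizeUncurryFin (oneForm ∘L b) ![X, Y] = _
  rw [ContinuousAlternatingMap.alternatizeUncurryFin_apply]
  simp [Fin.sum_univ_succ, sub_eq_add_neg, Fin.removeNth]

theorem extDeriv_oneForm {s : F → F →L[ℝ] ℝ} {z : F} (hs : DifferentiableAt ℝ s z) :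
    extDeriv (fun y => oneForm (s y)) z = skewForm (fderiv ℝ s z) := by
  have h : fderiv ℝ (fun y => oneForm (s y)) z = oneForm ∘L fderiv ℝ s z :=
    (oneForm.hasFDerivAt.comp z hs.hasFDerivAt).fderiv
  rw [extDeriv, h]
  rfl

theorem ext_oneForm {V : Type*} [AddCommGroup V] [Module ℝ V] [TopologicalSpace V]
    {α β : V [⋀^Fin 1]→L[ℝ] ℝ} (h : ∀ x, α ![x] = β ![x]) : α = β := by
  ext v
  have : v = ![v 0] := by funext i; fin_cases i; rfl
  rw [this, h]

theorem ext_twoForm {V : Type*} [AddCommGroup V] [Module ℝ V] [TopologicalSpace V]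
    {α β : V [⋀^Fin 2]→L[ℝ] ℝ} (h : ∀ x y, α ![x, y] = β ![x, y]) : α = β := by
  ext v
  have : v = ![v 0, v 1] := by funext i; fin_cases i <;> rfl
  rw [this, h]

theorem ext_threeForm {V : Type*} [AddCommGroup V] [Module ℝ V] [TopologicalSpace V]
    {α β : V [⋀^Fin 3]→L[ℝ] ℝ} (h : ∀ x y z, α ![x, y, z] = β ![x, y, z]) : α = β := by
  ext v
  have : v = ![v 0, v 1, v 2] := by funext i; fin_cases i <;> rfl
  rw [this, h]

end LowDegree

/-! ### Semi-basic covectors and horizontal projectors on `E × E`. -/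

section Product

variable {E : Type*} [NormedAddCommGroup E] [NormedSpace ℝ E]

/-- The covector `(a, b) ↦ f a` on `E × E`. -/
def semibasic : (E →L[ℝ] ℝ) →L[ℝ] (E × E →L[ℝ] ℝ) :=
  (ContinuousLinearMap.compL ℝ (E × E) E ℝ).flip (ContinuousLinearMap.fst ℝ E E)

@[simp]
theorem semibasic_apply (f : E →L[ℝ] ℝ) (X : E × E) : semibasic f X = f X.1 := rfl

theorem fderiv_semibasic {t : E × E → E →L[ℝ] ℝ} {z : E × E} (ht : DifferentiableAt ℝ t z) :
    fderiv ℝ (fun y => semibasic (t y)) z = semibasic ∘L fderiv ℝ t z :=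
  ((semibasic (E := E)).hasFDerivAt.comp z ht.hasFDerivAt).fderiv

/-- The projector `(a, b) ↦ (a, m a)` of `E × E` onto the graph of `m`. -/
def graphProj : (E →L[ℝ] E) → (E × E →L[ℝ] E × E) := fun m =>
  (ContinuousLinearMap.fst ℝ E E).prod (m ∘L ContinuousLinearMap.fst ℝ E E)

@[simp]
theorem graphProj_apply (m : E →L[ℝ] E) (X : E × E) : graphProj m X = (X.1, m X.1) := rfl

theorem hasFDerivAt_graphProj {k : E × E → E →L[ℝ] E} {z : E × E} (hk : DifferentiableAt ℝ k z) :
    DifferentiableAt ℝ (fun y => graphProj (k y)) z ∧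
      ∀ X Y, fderiv ℝ (fun y => graphProj (k y)) z X Y = (0, fderiv ℝ k z X Y.1) := by
  have e : ∀ m : E →L[ℝ] E, graphProj m =
      ContinuousLinearMap.inl ℝ E E ∘L ContinuousLinearMap.fst ℝ E E +
      ContinuousLinearMap.compL ℝ (E × E) E (E × E) (ContinuousLinearMap.inr ℝ E E)
        ((ContinuousLinearMap.compL ℝ (E × E) E E).flip (ContinuousLinearMap.fst ℝ E E) m) := by
    intro m
    ext X <;> simp
  have h : HasFDerivAt (fun y => graphProj (k y))
      (ContinuousLinearMap.compL ℝ (E × E) E (E × E) (ContinuousLinearMap.inr ℝ E E) ∘L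
        (ContinuousLinearMap.compL ℝ (E × E) E E).flip (ContinuousLinearMap.fst ℝ E E) ∘L
          fderiv ℝ k z) z := by
    simp only [e]
    refine HasFDerivAt.const_add _ ?_
    exact (ContinuousLinearMap.hasFDerivAt _).comp z
      ((ContinuousLinearMap.hasFDerivAt _).comp z hk.hasFDerivAt)
  refine ⟨h.differentiableAt, fun X Y => ?_⟩
  rw [h.fderiv]
  rfl

/-- The first component of `graphProj` is constant, so only the derivative of `k` along the
horizontal vectors survives. The factor 2 is cancelled by the `1/2` in `curvature`. -/
theorem fnBracket_graphProj {k : E × E → E →L[ℝ] E} {z : E × E} (hk : DifferentiableAt ℝ k z)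
    (X Y : E × E) :
    fnBracket (fun y => graphProj (k y)) (fun y => graphProj (k y)) z ![X, Y] =
      (2 : ℝ) • (0, fderiv ℝ k z (X.1, k z X.1) Y.1 - fderiv ℝ k z (Y.1, k z Y.1) X.1) := by
  obtain ⟨-, h⟩ := hasFDerivAt_graphProj hk
  have h1 : Fin.removeNth (α := fun _ => E × E) 1 ![X, Y] 0 = X := rfl
  rw [fnBracket, ContinuousAlternatingMap.alternatizeUncurryFin_apply]
  simp [Fin.sum_univ_succ, h1, h, two_smul]
  abel

end Product

end FrolicherNijenhuis

/-! ### The tangent bundle in charts. -/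

namespace Spray

open FrolicherNijenhuis

variable {n : ℕ} {M : Type*} [TopologicalSpace M] [ChartedSpace (EuclideanSpace ℝ (Fin n)) M]
  [IsManifold (𝓡 n) ∞ M]

theorem mem_source_iff {c v : TangentBundle (𝓡 n) M} :
    v ∈ (extChartAt (𝓡 n).tangent c).source ↔ v.1 ∈ (extChartAt (𝓡 n) c.1).source := by
  rw [extChartAt_source, extChartAt_source, TangentBundle.mem_chart_source_iff]

theorem extChartAt_snd {c v : TangentBundle (𝓡 n) M}
    (hv : v ∈ (extChartAt (𝓡 n).tangent c).source) :
    (extChartAt (𝓡 n).tangent c v).2 = mfderiv (𝓡 n) 𝓘(ℝ, EuclideanSpace ℝ (Fin n))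
      (extChartAt (𝓡 n) c.1) v.1 v.2 := by
  rw [mem_source_iff, extChartAt_source] at hv
  rw [← TangentBundle.continuousLinearMapAt_trivializationAt hv,
    TangentBundle.continuousLinearMapAt_trivializationAt_eq_core hv]
  rfl

/-- The first component of a chart of `TM` is the base chart composed with `π`; both sides
differentiate this one map. -/
theorem dChart_fst {c v : TangentBundle (𝓡 n) M}
    (hv : v ∈ (extChartAt (𝓡 n).tangent c).source) (ξ : TangentSpace (𝓡 n).tangent v) :
    (dChart c v ξ).1 = dChart c.1 v.1 (dProj M v ξ) := by
  have hv' := mem_source_iff.1 hv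
  have hm : IsManifold (𝓡 n).tangent 1 (TangentBundle (𝓡 n) M) := .of_le (n := ∞) (by simp)
  have h1 : MDifferentiableAt (𝓡 n).tangent 𝓘(ℝ, EuclideanSpace ℝ (Fin n) × EuclideanSpace ℝ (Fin n))
      (extChartAt (𝓡 n).tangent c) v :=
    mdifferentiableAt_extChartAt (by rwa [← extChartAt_source (I := (𝓡 n).tangent)])
  have h2 : MDifferentiableAt (𝓡 n) 𝓘(ℝ, EuclideanSpace ℝ (Fin n))
      (extChartAt (𝓡 n) c.1) v.1 :=
    mdifferentiableAt_extChartAt (by rwa [← extChartAt_source (I := 𝓡 n)])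
  have h3 : MDifferentiableAt (𝓡 n).tangent (𝓡 n) (fun w : TangentBundle (𝓡 n) M => w.1) v :=
    Bundle.mdifferentiableAt_proj _
  have h4 : HasMFDerivAt 𝓘(ℝ, EuclideanSpace ℝ (Fin n) × EuclideanSpace ℝ (Fin n))
    𝓘(ℝ, EuclideanSpace ℝ (Fin n)) Prod.fst (extChartAt (𝓡 n).tangent c v) (ContinuousLinearMap.fst ℝ
      (EuclideanSpace ℝ (Fin n)) (EuclideanSpace ℝ (Fin n))) :=
    HasFDerivAt.hasMFDerivAt hasFDerivAt_fst
  have e1 := (h4.comp v h1.hasMFDerivAt).mfderiv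
  have e2 := (h2.hasMFDerivAt.comp v h3.hasMFDerivAt).mfderiv
  exact DFunLike.congr_fun (e1.symm.trans e2) ξ

theorem dProj_eq_zero_iff {c v : TangentBundle (𝓡 n) M}
    (hv : v ∈ (extChartAt (𝓡 n).tangent c).source) (ξ : TangentSpace (𝓡 n).tangent v) :
    dProj M v ξ = 0 ↔ (dChart c v ξ).1 = 0 := by
  rw [dChart_fst hv]
  exact (map_eq_zero_iff _ (dChart_injective (mem_source_iff.1 hv))).symm

theorem mdifferentiableAt_fibre (x : M) (w₀ : EuclideanSpace ℝ (Fin n)) :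
    MDifferentiableAt 𝓘(ℝ, EuclideanSpace ℝ (Fin n)) (𝓡 n).tangent
      (fun w : EuclideanSpace ℝ (Fin n) => (⟨x, w⟩ : TangentBundle (𝓡 n) M)) w₀ := by
  have h : ContMDiffAt 𝓘(ℝ, EuclideanSpace ℝ (Fin n)) 𝓘(ℝ, EuclideanSpace ℝ (Fin n)) 1
      (fun w => (tangentBundleCore (𝓡 n) M).coordChange (achart _ x) (achart _ x) x w) w₀ :=
    (ContinuousLinearMap.contDiff _).contDiffAt.contMDiffAt
  have hs : ContMDiffAt 𝓘(ℝ, EuclideanSpace ℝ (Fin n)) (𝓡 n).tangent 1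
      (fun w : EuclideanSpace ℝ (Fin n) => (⟨x, w⟩ : TangentBundle (𝓡 n) M)) w₀ :=
    Bundle.contMDiffAt_totalSpace.2 ⟨contMDiffAt_const, h⟩
  exact hs.mdifferentiableAt (by simp)

/-- On a fibre, the chart of `TM` is constant in the base component and linear in the fibre
component, so its derivative is read off. -/
theorem dChart_mfderiv_fibre (c : TangentBundle (𝓡 n) M) {x : M}
    (hx : x ∈ (extChartAt (𝓡 n) c.1).source) (w₀ w : EuclideanSpace ℝ (Fin n)) :
    dChart c (⟨x, w₀⟩ : TangentBundle (𝓡 n) M)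
      (mfderiv 𝓘(ℝ, EuclideanSpace ℝ (Fin n)) (𝓡 n).tangent
        (fun w : EuclideanSpace ℝ (Fin n) => (⟨x, w⟩ : TangentBundle (𝓡 n) M)) w₀ w) =
      (0, dChart (I := 𝓡 n) c.1 x w) := by
  have hm : IsManifold (𝓡 n).tangent 1 (TangentBundle (𝓡 n) M) := .of_le (n := ∞) (by simp)
  have hv : (⟨x, w₀⟩ : TangentBundle (𝓡 n) M) ∈ (extChartAt (𝓡 n).tangent c).source :=
    mem_source_iff.2 hx
  have h1 : MDifferentiableAt (𝓡 n).tangent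
      𝓘(ℝ, EuclideanSpace ℝ (Fin n) × EuclideanSpace ℝ (Fin n))
      (extChartAt (𝓡 n).tangent c) (⟨x, w₀⟩ : TangentBundle (𝓡 n) M) :=
    mdifferentiableAt_extChartAt (by rwa [← extChartAt_source (I := (𝓡 n).tangent)])
  have e1 := (h1.hasMFDerivAt.comp w₀ (mdifferentiableAt_fibre x w₀).hasMFDerivAt).mfderiv
  have e2 : extChartAt (𝓡 n).tangent c ∘
      (fun w : EuclideanSpace ℝ (Fin n) => (⟨x, w⟩ : TangentBundle (𝓡 n) M)) =
      fun w => (extChartAt (𝓡 n) c.1 x, (dChart (I := 𝓡 n) c.1 x :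
        EuclideanSpace ℝ (Fin n) →L[ℝ] EuclideanSpace ℝ (Fin n)) w) := by
    funext w
    exact Prod.ext rfl (extChartAt_snd (v := ⟨x, w⟩) (mem_source_iff.2 hx))
  have e3 : HasFDerivAt (fun w : EuclideanSpace ℝ (Fin n) => (extChartAt (𝓡 n) c.1 x,
      (dChart (I := 𝓡 n) c.1 x : EuclideanSpace ℝ (Fin n) →L[ℝ] EuclideanSpace ℝ (Fin n)) w))
      ((0 : EuclideanSpace ℝ (Fin n) →L[ℝ] EuclideanSpace ℝ (Fin n)).prod
        (dChart (I := 𝓡 n) c.1 x : EuclideanSpace ℝ (Fin n) →L[ℝ] EuclideanSpace ℝ (Fin n))) w₀ :=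
    (hasFDerivAt_const _ _).prodMk (ContinuousLinearMap.hasFDerivAt _)
  rw [e2] at e1
  exact DFunLike.congr_fun (e1.symm.trans e3.hasMFDerivAt.mfderiv) w

theorem dChart_vertLift {c v : TangentBundle (𝓡 n) M}
    (hv : v ∈ (extChartAt (𝓡 n).tangent c).source) (w : TangentSpace (𝓡 n) v.1) :
    dChart c v (vertLift M v w) = (0, dChart c.1 v.1 w) :=
  dChart_mfderiv_fibre c (mem_source_iff.1 hv) v.2 w

theorem dChart_liouville {c v : TangentBundle (𝓡 n) M}
    (hv : v ∈ (extChartAt (𝓡 n).tangent c).source) :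
    dChart c v (liouville M v) = (0, (extChartAt (𝓡 n).tangent c v).2) := by
  rw [liouville, dChart_vertLift hv, extChartAt_snd hv]
  rfl

theorem dChart_tangentStructure {c v : TangentBundle (𝓡 n) M}
    (hv : v ∈ (extChartAt (𝓡 n).tangent c).source) (ξ : TangentSpace (𝓡 n).tangent v) :
    dChart c v (tangentStructure M v ξ) = (0, (dChart c v ξ).1) := by
  rw [dChart_fst hv]
  exact dChart_vertLift hv _

theorem mem_slashed_iff {c v : TangentBundle (𝓡 n) M}
    (hv : v ∈ (extChartAt (𝓡 n).tangent c).source) :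
    v ∈ slashed M ↔ (extChartAt (𝓡 n).tangent c v).2 ≠ 0 := by
  rw [extChartAt_snd hv]
  exact (map_ne_zero_iff _ (dChart_injective (mem_source_iff.1 hv))).symm

theorem isOpen_slashed : IsOpen (slashed (n := n) M) := by
  rw [isOpen_iff_mem_nhds]
  intro v hv
  have hs := mem_extChartAt_source (I := (𝓡 n).tangent) v
  have h1 : ContinuousAt (fun w => (extChartAt (𝓡 n).tangent v w).2) v :=
    (continuousAt_extChartAt v).snd
  filter_upwards [extChartAt_source_mem_nhds (I := (𝓡 n).tangent) v,
    h1.eventually_ne ((mem_slashed_iff hs).1 hv)] with w hw hw'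
  exact (mem_slashed_iff hw).2 hw'

end Spray

/-! ### Smoothness and Lie brackets of vector fields in charts. -/

namespace FrolicherNijenhuis

section VectorFields

variable {F : Type*} [NormedAddCommGroup F] [NormedSpace ℝ F] {H : Type*} [TopologicalSpace H]
  {I : ModelWithCorners ℝ F H} {N : Type*} [TopologicalSpace N]
  [ChartedSpace H N] [IsManifold I ∞ N]

/-- The trivialization of the tangent bundle at `c` acts on the fibres as `dChart c`. -/
theorem contMDiffAt_vectorField_iff (X : VField I N) {c b : N}
    (hb : b ∈ (extChartAt I c).source) :
    ContMDiffAt I I.tangent ∞ (fun x => (⟨x, X x⟩ : TangentBundle I N)) b ↔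
      ContMDiffAt I 𝓘(ℝ, F) ∞ (fun x => (dChart c x (X x) : F)) b := by
  have : IsManifold I 1 N := .of_le (n := ∞) (by simp)
  have h1 := (trivializationAt F (TangentSpace I) c).contMDiffAt_section_iff (IB := I) (n := ∞)
    (s := X) (x₀ := b) (by rwa [extChartAt_source] at hb)
  refine Iff.trans h1 (Filter.EventuallyEq.contMDiffAt_iff ?_)
  filter_upwards [(isOpen_extChartAt_source (I := I) c).mem_nhds hb] with x hx
  rw [extChartAt_source] at hx
  have h2 := TangentBundle.continuousLinearMapAt_trivializationAt (I := I) hx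
  have h3 := DFunLike.congr_fun h2 (X x)
  refine Eq.trans ?_ h3
  change _ = (trivializationAt F (TangentSpace I) c).linearMapAt ℝ x (X x)
  rw [Bundle.Trivialization.coe_linearMapAt_of_mem _ hx]

variable [I.Boundaryless]

theorem contMDiffAt_extChartAt_symm {c : N} {y : F} (hy : y ∈ (extChartAt I c).target) :
    ContMDiffAt 𝓘(ℝ, F) I ∞ (extChartAt I c).symm y :=
  (contMDiffOn_extChartAt_symm c).contMDiffAt ((isOpen_extChartAt_target c).mem_nhds hy)

theorem VField.contDiffAt_inChart {X : VField I N} {c : N} {y : F}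
    (hy : y ∈ (extChartAt I c).target)
    (hX : ContMDiffAt I I.tangent ∞ (fun x => (⟨x, X x⟩ : TangentBundle I N))
      ((extChartAt I c).symm y)) :
    ContDiffAt ℝ ∞ (X.inChart c) y := by
  have h1 := (contMDiffAt_vectorField_iff X ((extChartAt I c).map_target hy)).1 hX
  exact (h1.comp y (contMDiffAt_extChartAt_symm hy)).contDiffAt

theorem dChartSymm_inverse {c : N} {y : F} (hy : y ∈ (extChartAt I c).target)
    (ξ : TangentSpace I ((extChartAt I c).symm y)) :
    (dChartSymm (I := I) c y).inverse ξ = dChart c _ ξ := by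
  let e : F ≃L[ℝ] TangentSpace I ((extChartAt I c).symm y) :=
    ContinuousLinearEquiv.equivOfInverse (dChartSymm (I := I) c y) (dChart c _)
      (dChart_dChartSymm hy) (dChartSymm_dChart hy)
  change (e : F →L[ℝ] _).inverse ξ = _
  rw [ContinuousLinearMap.inverse_equiv]
  rfl

/-- Near `y`, the coordinate expression is the pullback along the inverse chart, and the bracket
commutes with pullback. -/
theorem VField.inChart_mlieBracket [CompleteSpace F] {X Y : VField I N} {c : N} {y : F}
    (hy : y ∈ (extChartAt I c).target)
    (hX : ContMDiffAt I I.tangent ∞ (fun x => (⟨x, X x⟩ : TangentBundle I N))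
      ((extChartAt I c).symm y))
    (hY : ContMDiffAt I I.tangent ∞ (fun x => (⟨x, Y x⟩ : TangentBundle I N))
      ((extChartAt I c).symm y)) :
    VField.inChart (VectorField.mlieBracket I X Y) c y =
      VectorField.lieBracket ℝ (X.inChart c) (Y.inChart c) y := by
  have : IsManifold I (minSmoothness ℝ 2) N := .of_le (n := ∞) (by simpa using two_le_infty)
  have key := VectorField.mpullback_mlieBracket (n := ∞) (I := 𝓘(ℝ, F))
    (hX.mdifferentiableAt (by simp))
    (hY.mdifferentiableAt (by simp)) (contMDiffAt_extChartAt_symm hy)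
    (by simpa using two_le_infty)
  have e : ∀ Z : VField I N, VectorField.mpullback 𝓘(ℝ, F) I (extChartAt I c).symm Z =ᶠ[𝓝 y]
      Z.inChart c := by
    intro Z
    filter_upwards [(isOpen_extChartAt_target c).mem_nhds hy] with z hz
    exact dChartSymm_inverse hz _
  refine Eq.trans (e _).self_of_nhds.symm (key.trans ?_)
  rw [(e X).mlieBracket_vectorField_eq (e Y)]
  refine Eq.trans (congrFun (VectorField.mlieBracketWithin_eq_lieBracketWithin
    (V := X.inChart c) (W := Y.inChart c) (s := Set.univ)) y) ?_
  rw [VectorField.lieBracketWithin_univ]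

end VectorFields

end FrolicherNijenhuis

/-! ### Sprays, their connection and their curvature in coordinates. -/

namespace Spray

open FrolicherNijenhuis

variable {n : ℕ} {M : Type*} [TopologicalSpace M] [ChartedSpace (EuclideanSpace ℝ (Fin n)) M]
  [IsManifold (𝓡 n) ∞ M]

/-- The second component of the coordinate expression of a spray. -/
def accel (S : VField (𝓡 n).tangent (TangentBundle (𝓡 n) M)) (c : TangentBundle (𝓡 n) M)
    (z : EuclideanSpace ℝ (Fin n) × EuclideanSpace ℝ (Fin n)) : EuclideanSpace ℝ (Fin n) :=
  (S.inChart c z).2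

/-- The coefficients of the nonlinear connection: the horizontal lift of `a` is
`(a, coeff S c z a)`. -/
def coeff (S : VField (𝓡 n).tangent (TangentBundle (𝓡 n) M)) (c : TangentBundle (𝓡 n) M)
    (z : EuclideanSpace ℝ (Fin n) × EuclideanSpace ℝ (Fin n)) :
    EuclideanSpace ℝ (Fin n) →L[ℝ] EuclideanSpace ℝ (Fin n) :=
  (1 / 2 : ℝ) • (ContinuousLinearMap.compL ℝ _ _ _).flip (ContinuousLinearMap.inr ℝ _ _)
    (fderiv ℝ (accel S c) z)

theorem coeff_apply (S : VField (𝓡 n).tangent (TangentBundle (𝓡 n) M))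
    (c : TangentBundle (𝓡 n) M)
    (z : EuclideanSpace ℝ (Fin n) × EuclideanSpace ℝ (Fin n)) (a : EuclideanSpace ℝ (Fin n)) :
    coeff S c z a = (1 / 2 : ℝ) • fderiv ℝ (accel S c) z (0, a) := rfl

theorem snd_ne_zero {c : TangentBundle (𝓡 n) M}
    {z : EuclideanSpace ℝ (Fin n) × EuclideanSpace ℝ (Fin n)}
    (hz : z ∈ (extChartAt (𝓡 n).tangent c).target) :
    (extChartAt (𝓡 n).tangent c).symm z ∈ slashed M ↔ z.2 ≠ 0 := by
  rw [mem_slashed_iff ((extChartAt (𝓡 n).tangent c).map_target hz),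
    (extChartAt (𝓡 n).tangent c).right_inv hz]

/-- The coordinate domain of the slashed tangent bundle. -/
def domain (c : TangentBundle (𝓡 n) M) :
    Set (EuclideanSpace ℝ (Fin n) × EuclideanSpace ℝ (Fin n)) :=
  {z | z ∈ (extChartAt (𝓡 n).tangent c).target ∧ z.2 ≠ 0}

theorem isOpen_domain (c : TangentBundle (𝓡 n) M) : IsOpen (domain c) :=
  (isOpen_extChartAt_target c).inter (isOpen_ne_fun continuous_snd continuous_const)

theorem extChartAt_mem_domain {c v : TangentBundle (𝓡 n) M}
    (hv : v ∈ (extChartAt (𝓡 n).tangent c).source) (hv' : v ∈ slashed M) :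
    extChartAt (𝓡 n).tangent c v ∈ domain c :=
  ⟨(extChartAt (𝓡 n).tangent c).map_source hv, (mem_slashed_iff hv).1 hv'⟩

theorem inChart_liouville {c : TangentBundle (𝓡 n) M}
    {z : EuclideanSpace ℝ (Fin n) × EuclideanSpace ℝ (Fin n)}
    (hz : z ∈ (extChartAt (𝓡 n).tangent c).target) :
    (liouville M).inChart c z = (0, z.2) := by
  refine (dChart_liouville ((extChartAt (𝓡 n).tangent c).map_target hz)).trans ?_
  rw [(extChartAt (𝓡 n).tangent c).right_inv hz]

theorem contMDiffAt_liouville (v : TangentBundle (𝓡 n) M) :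
    ContMDiffAt (𝓡 n).tangent (𝓡 n).tangent.tangent ∞
      (fun x => (⟨x, liouville M x⟩ : TangentBundle (𝓡 n).tangent (TangentBundle (𝓡 n) M))) v := by
  rw [contMDiffAt_vectorField_iff (liouville M) (mem_extChartAt_source v)]
  have h1 : ContMDiffAt (𝓡 n).tangent
      𝓘(ℝ, EuclideanSpace ℝ (Fin n) × EuclideanSpace ℝ (Fin n)) ∞
      (fun x => ((0 : EuclideanSpace ℝ (Fin n)), (extChartAt (𝓡 n).tangent v x).2)) v := by
    have h2 : ContDiff ℝ ∞ (fun p : EuclideanSpace ℝ (Fin n) × EuclideanSpace ℝ (Fin n) =>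
        ((0 : EuclideanSpace ℝ (Fin n)), p.2)) := by fun_prop
    exact h2.contDiffAt.contMDiffAt.comp v (contMDiffAt_extChartAt (n := ∞))
  refine h1.congr_of_eventuallyEq ?_
  filter_upwards [extChartAt_source_mem_nhds (I := (𝓡 n).tangent) v] with x hx
  exact dChart_liouville hx

variable {S : VField (𝓡 n).tangent (TangentBundle (𝓡 n) M)}

theorem contDiffAt_inChart (hS : IsSpray S) {c : TangentBundle (𝓡 n) M}
    {z : EuclideanSpace ℝ (Fin n) × EuclideanSpace ℝ (Fin n)} (hz : z ∈ domain c) :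
    ContDiffAt ℝ ∞ (S.inChart c) z :=
  VField.contDiffAt_inChart hz.1
    (hS.smooth.contMDiffAt (isOpen_slashed.mem_nhds ((snd_ne_zero hz.1).2 hz.2)))

theorem contDiffAt_accel (hS : IsSpray S) {c : TangentBundle (𝓡 n) M}
    {z : EuclideanSpace ℝ (Fin n) × EuclideanSpace ℝ (Fin n)} (hz : z ∈ domain c) :
    ContDiffAt ℝ ∞ (accel S c) z :=
  contDiffAt_snd.comp z (contDiffAt_inChart hS hz)

theorem contDiffAt_coeff (hS : IsSpray S) {c : TangentBundle (𝓡 n) M}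
    {z : EuclideanSpace ℝ (Fin n) × EuclideanSpace ℝ (Fin n)} (hz : z ∈ domain c) :
    ContDiffAt ℝ ∞ (coeff S c) z := by
  have h := (contDiffAt_accel hS hz).fderiv_right (m := ∞) (by simp)
  exact ContDiffAt.const_smul _ ((ContinuousLinearMap.contDiff _).contDiffAt.comp z h)

theorem inChart_spray (hS : IsSpray S) {c : TangentBundle (𝓡 n) M}
    {z : EuclideanSpace ℝ (Fin n) × EuclideanSpace ℝ (Fin n)} (hz : z ∈ domain c) :
    S.inChart c z = (z.2, accel S c z) := by
  refine Prod.ext ?_ rfl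
  have hs := (extChartAt (𝓡 n).tangent c).map_target hz.1
  have h := hS.secondOrder _ ((snd_ne_zero hz.1).2 hz.2)
  have h2 := congrArg (dChart c _) h
  rw [dChart_tangentStructure hs, dChart_liouville hs,
    (extChartAt (𝓡 n).tangent c).right_inv hz.1] at h2
  exact congrArg Prod.snd h2

theorem fderiv_spray (hS : IsSpray S) {c : TangentBundle (𝓡 n) M}
    {z : EuclideanSpace ℝ (Fin n) × EuclideanSpace ℝ (Fin n)} (hz : z ∈ domain c)
    (X : EuclideanSpace ℝ (Fin n) × EuclideanSpace ℝ (Fin n)) :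
    fderiv ℝ (S.inChart c) z X = (X.2, fderiv ℝ (accel S c) z X) := by
  have h1 : S.inChart c =ᶠ[𝓝 z] fun z => (z.2, accel S c z) := by
    filter_upwards [(isOpen_domain c).mem_nhds hz] with w hw using inChart_spray hS hw
  rw [h1.fderiv_eq]
  have h2 : HasFDerivAt (fun z => (z.2, accel S c z)) ((ContinuousLinearMap.snd ℝ _ _).prod
      (fderiv ℝ (accel S c) z)) z :=
    hasFDerivAt_snd.prodMk ((contDiffAt_accel hS hz).differentiableAt (by simp)).hasFDerivAt
  rw [h2.fderiv]
  rfl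

/-- This is Euler's relation: the second component of `[ℂ, S] = S` reads `∂_y A · y - A = A`, so `A`
is homogeneous of degree 2 in the fibre. -/
theorem fderiv_accel_vertical (hS : IsSpray S) {c : TangentBundle (𝓡 n) M}
    {z : EuclideanSpace ℝ (Fin n) × EuclideanSpace ℝ (Fin n)} (hz : z ∈ domain c) :
    fderiv ℝ (accel S c) z (0, z.2) = (2 : ℝ) • accel S c z := by
  have hs := (snd_ne_zero hz.1).2 hz.2
  have h1 := VField.inChart_mlieBracket hz.1 (contMDiffAt_liouville _)
    (hS.smooth.contMDiffAt (isOpen_slashed.mem_nhds hs))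
  have h2 : VField.inChart (VectorField.mlieBracket (𝓡 n).tangent (liouville M) S) c z =
      S.inChart c z := congrArg (dChart c _) (hS.homogeneous _ hs)
  have h3 : (liouville M).inChart c =ᶠ[𝓝 z] fun z => (0, z.2) := by
    filter_upwards [(isOpen_domain c).mem_nhds hz] with w hw using inChart_liouville hw.1
  have h4 : HasFDerivAt (fun z : EuclideanSpace ℝ (Fin n) × EuclideanSpace ℝ (Fin n) =>
      ((0 : EuclideanSpace ℝ (Fin n)), z.2)) ((0 : EuclideanSpace ℝ (Fin n) ×
        EuclideanSpace ℝ (Fin n) →L[ℝ] EuclideanSpace ℝ (Fin n)).prod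
          (ContinuousLinearMap.snd ℝ _ _)) z :=
    (hasFDerivAt_const _ _).prodMk hasFDerivAt_snd
  rw [h2, VectorField.lieBracket, h3.fderiv_eq, h4.fderiv, h3.self_of_nhds,
    fderiv_spray hS hz, inChart_spray hS hz] at h1
  have h5 := congrArg Prod.snd h1
  simp only [Prod.snd_sub, ContinuousLinearMap.prod_apply, ContinuousLinearMap.coe_snd'] at h5
  rw [two_smul]
  exact (sub_eq_iff_eq_add.1 h5.symm)

theorem fderiv_coeff_apply (hS : IsSpray S) {c : TangentBundle (𝓡 n) M}
    {z : EuclideanSpace ℝ (Fin n) × EuclideanSpace ℝ (Fin n)} (hz : z ∈ domain c)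
    (X : EuclideanSpace ℝ (Fin n) × EuclideanSpace ℝ (Fin n)) (a : EuclideanSpace ℝ (Fin n)) :
    fderiv ℝ (coeff S c) z X a =
      (1 / 2 : ℝ) • fderiv ℝ (fderiv ℝ (accel S c)) z X (0, a) := by
  have h := ((contDiffAt_accel hS hz).fderiv_right (m := ∞) (by simp)).differentiableAt (by simp)
  have h2 := HasFDerivAt.const_smul (((ContinuousLinearMap.compL ℝ (EuclideanSpace ℝ (Fin n))
    (EuclideanSpace ℝ (Fin n) × EuclideanSpace ℝ (Fin n)) (EuclideanSpace ℝ (Fin n))).flip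
      (ContinuousLinearMap.inr ℝ _ _)).hasFDerivAt.comp z h.hasFDerivAt) (1 / 2 : ℝ)
  have h3 : fderiv ℝ (coeff S c) z = _ := h2.fderiv
  rw [h3]
  rfl

/-- The connection is torsion-free: its coefficients are fibre derivatives of one function, and
second derivatives commute. -/
theorem fderiv_coeff_symm (hS : IsSpray S) {c : TangentBundle (𝓡 n) M}
    {z : EuclideanSpace ℝ (Fin n) × EuclideanSpace ℝ (Fin n)} (hz : z ∈ domain c)
    (a b : EuclideanSpace ℝ (Fin n)) :
    fderiv ℝ (coeff S c) z (0, b) a = fderiv ℝ (coeff S c) z (0, a) b := by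
  rw [fderiv_coeff_apply hS hz, fderiv_coeff_apply hS hz,
    ((contDiffAt_accel hS hz).isSymmSndFDerivAt (by simpa using two_le_infty)).eq]

/-- Differentiating Euler's relation of degree 2 along the fibre gives that of degree 1 for `∂_y A`;
the symmetry of the second derivative puts `y` in the last slot. -/
theorem fderiv_coeff_vertical (hS : IsSpray S) {c : TangentBundle (𝓡 n) M}
    {z : EuclideanSpace ℝ (Fin n) × EuclideanSpace ℝ (Fin n)} (hz : z ∈ domain c)
    (b : EuclideanSpace ℝ (Fin n)) :
    fderiv ℝ (coeff S c) z (0, b) z.2 = coeff S c z b := by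
  have h := ((contDiffAt_accel hS hz).fderiv_right (m := ∞) (by simp)).differentiableAt (by simp)
  have ha := (contDiffAt_accel hS hz).differentiableAt (by simp)
  have h1 : (fun w => fderiv ℝ (accel S c) w (0, w.2)) =ᶠ[𝓝 z]
      fun w => (2 : ℝ) • accel S c w := by
    filter_upwards [(isOpen_domain c).mem_nhds hz] with w hw using fderiv_accel_vertical hS hw
  have h4 : HasFDerivAt (fun z : EuclideanSpace ℝ (Fin n) × EuclideanSpace ℝ (Fin n) =>
      ((0 : EuclideanSpace ℝ (Fin n)), z.2)) ((0 : EuclideanSpace ℝ (Fin n) ×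
        EuclideanSpace ℝ (Fin n) →L[ℝ] EuclideanSpace ℝ (Fin n)).prod
          (ContinuousLinearMap.snd ℝ _ _)) z :=
    (hasFDerivAt_const _ _).prodMk hasFDerivAt_snd
  have h5 := DFunLike.congr_fun (h1.fderiv_eq (𝕜 := ℝ)) (0, b)
  rw [fderiv_clm_apply h h4.differentiableAt, h4.fderiv, fderiv_fun_const_smul ha] at h5
  rw [fderiv_coeff_apply hS hz, coeff_apply]
  simp [two_smul] at h5
  rw [h5]

theorem inChart_tangentStructure {c : TangentBundle (𝓡 n) M}
    {z : EuclideanSpace ℝ (Fin n) × EuclideanSpace ℝ (Fin n)}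
    (hz : z ∈ (extChartAt (𝓡 n).tangent c).target) :
    (tangentStructure M).inChart c z =
      ContinuousLinearMap.inr ℝ _ _ ∘L ContinuousLinearMap.fst ℝ _ _ :=
  EndField.inChart_eq hz fun ξ =>
    dChart_tangentStructure ((extChartAt (𝓡 n).tangent c).map_target hz) ξ

theorem inChart_tangentStructure_eventuallyEq {c : TangentBundle (𝓡 n) M}
    {z : EuclideanSpace ℝ (Fin n) × EuclideanSpace ℝ (Fin n)}
    (hz : z ∈ (extChartAt (𝓡 n).tangent c).target) :
    (tangentStructure M).inChart c =ᶠ[𝓝 z]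
      fun _ => ContinuousLinearMap.inr ℝ _ _ ∘L ContinuousLinearMap.fst ℝ _ _ := by
  filter_upwards [(isOpen_extChartAt_target c).mem_nhds hz] with w hw
    using inChart_tangentStructure hw

/-- In the chart, `J` is the constant map `(a, b) ↦ (0, a)`, so `ℒ_S J = J ∘ S' - S' ∘ J`, which
sends `(a, b)` to `(-a, b - ∂_y A · a)`. -/
theorem dChart_horizontal (hS : IsSpray S) {c v : TangentBundle (𝓡 n) M}
    (hv : v ∈ (extChartAt (𝓡 n).tangent c).source) (hv' : v ∈ slashed M)
    (ξ : TangentSpace (𝓡 n).tangent v) :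
    dChart c v (horizontal S v ξ) =
      graphProj (coeff S c (extChartAt (𝓡 n).tangent c v)) (dChart c v ξ) := by
  have hd := extChartAt_mem_domain hv hv'
  have hd' := extChartAt_mem_domain (mem_extChartAt_source v) hv'
  have h1 := dChart_lieDeriv hv ((contDiffAt_inChart hS hd').differentiableAt (by simp))
    ((inChart_tangentStructure_eventuallyEq hd'.1).differentiableAt_iff.2
      (differentiableAt_const _))
    ((contDiffAt_inChart hS hd).differentiableAt (by simp))
    ((inChart_tangentStructure_eventuallyEq hd.1).differentiableAt_iff.2
      (differentiableAt_const _)) ξ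
  have h2 : dChart c v (horizontal S v ξ) =
      (1 / 2 : ℝ) • (dChart c v ξ - dChart c v (lieDeriv S (tangentStructure M) v ξ)) := by
    change dChart c v ((1 / 2 : ℝ) • (ξ - lieDeriv S (tangentStructure M) v ξ)) = _
    rw [map_smul, map_sub]
  rw [h2, h1, lieEnd, (inChart_tangentStructure_eventuallyEq hd.1).fderiv_eq,
    inChart_tangentStructure hd.1]
  generalize dChart c v ξ = X
  rw [fderiv_const_apply]
  have h3 := fderiv_spray hS hd
  generalize extChartAt (𝓡 n).tangent c v = z at h3
  ext1
  · simp [h3]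
    rw [← add_smul]
    norm_num
  · simp [h3, coeff_apply]

theorem inChart_horizontal (hS : IsSpray S) {c : TangentBundle (𝓡 n) M}
    {z : EuclideanSpace ℝ (Fin n) × EuclideanSpace ℝ (Fin n)} (hz : z ∈ domain c) :
    (horizontal S).inChart c z = graphProj (coeff S c z) :=
  EndField.inChart_eq hz.1 fun ξ => by
    have h := dChart_horizontal hS ((extChartAt (𝓡 n).tangent c).map_target hz.1)
      ((snd_ne_zero hz.1).2 hz.2) ξ
    rwa [(extChartAt (𝓡 n).tangent c).right_inv hz.1] at h

theorem dChart_curvature (hS : IsSpray S) {v : TangentBundle (𝓡 n) M} (hv : v ∈ slashed M)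
    (w : Fin 2 → TangentSpace (𝓡 n).tangent v) :
    dChart v v (curvature S v w) =
      (1 / 2 : ℝ) • fnBracket (fun y => graphProj (coeff S v y)) (fun y => graphProj (coeff S v y))
        (extChartAt (𝓡 n).tangent v v) fun i => dChart v v (w i) := by
  have hd := extChartAt_mem_domain (mem_extChartAt_source v) hv
  have h1 : (horizontal S).inChart v =ᶠ[𝓝 (extChartAt (𝓡 n).tangent v v)]
      fun y => graphProj (coeff S v y) := by
    filter_upwards [(isOpen_domain v).mem_nhds hd] with y hy using inChart_horizontal hS hy
  have h2 : dChart v v (curvature S v w) =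
      (1 / 2 : ℝ) • dChart v v (ofCoord v (fnBracket ((horizontal S).inChart v)
        ((horizontal S).inChart v) (extChartAt (𝓡 n).tangent v v) fun i => dChart v v (w i))) :=
    map_smul (dChart v v) (1 / 2 : ℝ) _
  rw [h2, dChart_ofCoord, fnBracket, fnBracket, h1.fderiv_eq, h1.self_of_nhds]

/-- The curvature is vertical, which makes `i_R θ` vanish for semi-basic `θ`, so that `d_R θ = i_R
dθ`. -/
theorem dProj_curvature (hS : IsSpray S) {v : TangentBundle (𝓡 n) M} (hv : v ∈ slashed M)
    (w : Fin 2 → TangentSpace (𝓡 n).tangent v) : dProj M v (curvature S v w) = 0 := by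
  have hd := extChartAt_mem_domain (mem_extChartAt_source v) hv
  rw [dProj_eq_zero_iff (mem_extChartAt_source v), dChart_curvature hS hv]
  have : (fun i => dChart v v (w i)) = ![dChart v v (w 0), dChart v v (w 1)] := by
    funext i; fin_cases i <;> rfl
  rw [this, fnBracket_graphProj ((contDiffAt_coeff hS hd).differentiableAt (by simp))]
  simp

end Spray

namespace FrolicherNijenhuis

theorem compContinuousLinearMap_eq_zero_iff {V W : Type*} [AddCommGroup V] [Module ℝ V]
    [TopologicalSpace V] [AddCommGroup W] [Module ℝ W] [TopologicalSpace W] {k : ℕ}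
    {β : W [⋀^Fin k]→L[ℝ] ℝ} {D : V →L[ℝ] W} (hD : Function.Surjective D) :
    β.compContinuousLinearMap D = 0 ↔ β = 0 := by
  constructor
  · intro h
    ext w
    choose v hv using fun i => hD (w i)
    have := DFunLike.congr_fun h v
    obtain rfl : (fun i => D (v i)) = w := funext hv
    exact this
  · rintro rfl
    rfl

end FrolicherNijenhuis

/-! ### Semi-basic forms and the operators `ℒ_ℂ`, `d_J`, `d_h`, `d_R` in coordinates. -/

namespace Spray

open FrolicherNijenhuis

variable {n : ℕ} {M : Type*} [TopologicalSpace M] [ChartedSpace (EuclideanSpace ℝ (Fin n)) M]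
  [IsManifold (𝓡 n) ∞ M]

/-- The covector `a ↦ β (a, 0)` of a `1`-form `β` on `E × E`. -/
def horizontalPart {E : Type*} [NormedAddCommGroup E] [NormedSpace ℝ E] :
    ((E × E) [⋀^Fin 1]→L[ℝ] ℝ) →L[ℝ] (E →L[ℝ] ℝ) :=
  (ContinuousLinearMap.compL ℝ E (E × E) ℝ).flip (ContinuousLinearMap.inl ℝ E E) ∘L
    ((ContinuousAlternatingMap.ofSubsingletonLIE (𝕜 := ℝ) (E := E × E) (F := ℝ) (0 : Fin 1)).symm :
      ((E × E) [⋀^Fin 1]→L[ℝ] ℝ) →L[ℝ] (E × E →L[ℝ] ℝ))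

theorem horizontalPart_apply {E : Type*} [NormedAddCommGroup E] [NormedSpace ℝ E]
    (β : (E × E) [⋀^Fin 1]→L[ℝ] ℝ) (a : E) : horizontalPart β a = β ![(a, 0)] := by
  change β _ = _
  congr 1
  funext i
  fin_cases i; rfl

theorem horizontalPart_oneForm {E : Type*} [NormedAddCommGroup E] [NormedSpace ℝ E]
    (f : E →L[ℝ] ℝ) : horizontalPart (oneForm (semibasic f)) = f := by
  ext a
  simp [horizontalPart_apply]

/-- The curvature of the distribution of the subspaces `{(a, k z a)}` of `E × E`. -/
def curvatureCoeff {E : Type*} [NormedAddCommGroup E] [NormedSpace ℝ E] (k : E × E → E →L[ℝ] E)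
    (z : E × E) (a b : E) : E :=
  fderiv ℝ k z (a, k z a) b - fderiv ℝ k z (b, k z b) a

/-- The components `t` of a semi-basic form `θ = t_i dxⁱ` in the chart at `c`. -/
def components (θ : Form (𝓡 n).tangent (TangentBundle (𝓡 n) M) 1) (c : TangentBundle (𝓡 n) M)
    (z : EuclideanSpace ℝ (Fin n) × EuclideanSpace ℝ (Fin n)) :
    EuclideanSpace ℝ (Fin n) →L[ℝ] ℝ :=
  horizontalPart (θ.inChart c z)

/-- Near `v`, the form `θ` is semi-basic and its components in the chart at `c` are
differentiable. -/
structure SemibasicNear (θ : Form (𝓡 n).tangent (TangentBundle (𝓡 n) M) 1)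
    (c v : TangentBundle (𝓡 n) M) : Prop where
  mem_source : v ∈ (extChartAt (𝓡 n).tangent c).source
  semibasic : ∀ᶠ w in 𝓝 v, IsSemibasicAt θ w
  inChart_eq : θ.inChart c =ᶠ[𝓝 (extChartAt (𝓡 n).tangent c v)]
    fun z => oneForm (FrolicherNijenhuis.semibasic (components θ c z))
  differentiableAt : DifferentiableAt ℝ (components θ c) (extChartAt (𝓡 n).tangent c v)

theorem inChart_eq_of_isSemibasicAt {θ : Form (𝓡 n).tangent (TangentBundle (𝓡 n) M) 1}
    {c : TangentBundle (𝓡 n) M} {z : EuclideanSpace ℝ (Fin n) × EuclideanSpace ℝ (Fin n)}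
    (hz : z ∈ (extChartAt (𝓡 n).tangent c).target)
    (h : IsSemibasicAt θ ((extChartAt (𝓡 n).tangent c).symm z)) :
    θ.inChart c z = oneForm (semibasic (components θ c z)) := by
  refine ext_oneForm fun X => ?_
  have hs := (extChartAt (𝓡 n).tangent c).map_target hz
  have h1 : θ.inChart c z ![(0, X.2)] = 0 := by
    refine Eq.trans ?_ (h (dChartSymm c z (0, X.2)) ?_)
    · change θ _ _ = θ _ _
      congr 1
      funext i
      fin_cases i; rfl
    · rw [dProj_eq_zero_iff hs, dChart_dChartSymm hz]
  have h2 : X = (X.1, 0) + (0, X.2) := by simp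
  have h3 : θ.inChart c z ![X] = θ.inChart c z ![(X.1, 0)] + θ.inChart c z ![(0, X.2)] := by
    conv_lhs => rw [h2]
    exact (θ.inChart c z).cons_add ![] _ _
  rw [h3, h1, add_zero, oneForm_apply]
  exact (horizontalPart_apply _ _).symm

theorem LocalSection.eventually_contDiffAt {u : TangentBundle (𝓡 n) M} (θ : LocalSection u) :
    ∀ᶠ z in 𝓝 (extChartAt (𝓡 n).tangent u u), ContDiffAt ℝ ∞ (components θ.1 u) z := by
  filter_upwards [θ.2.1] with z hz
  exact horizontalPart.contDiff.contDiffAt.comp z hz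

theorem LocalSection.eventually_semibasicNear {u : TangentBundle (𝓡 n) M} (θ : LocalSection u) :
    ∀ᶠ v in 𝓝 u, SemibasicNear θ.1 u v := by
  have hc := continuousAt_extChartAt (I := (𝓡 n).tangent) u
  have h1 : ∀ᶠ z in 𝓝 (extChartAt (𝓡 n).tangent u u),
      θ.1.inChart u z = oneForm (semibasic (components θ.1 u z)) := by
    filter_upwards [eventually_mem_target_inter (I := (𝓡 n).tangent) u θ.2.2] with z hz
    exact inChart_eq_of_isSemibasicAt hz.1 hz.2
  filter_upwards [extChartAt_source_mem_nhds (I := (𝓡 n).tangent) u, hc.eventually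
    (eventually_eventually_nhds.2 h1), hc.eventually θ.eventually_contDiffAt,
    eventually_eventually_nhds.2 θ.2.2] with v hv1 hv2 hv3 hv4
  exact ⟨hv1, hv4, hv2, hv3.differentiableAt (by simp)⟩

namespace SemibasicNear

variable {θ : Form (𝓡 n).tangent (TangentBundle (𝓡 n) M) 1} {c v : TangentBundle (𝓡 n) M}

theorem extD_eq (h : SemibasicNear θ c v) :
    extD θ v = (skewForm (FrolicherNijenhuis.semibasic ∘L
      fderiv ℝ (components θ c) (extChartAt (𝓡 n).tangent c v))).compContinuousLinearMap
        (dChart c v) := by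
  have hd : DifferentiableAt ℝ (fun z => FrolicherNijenhuis.semibasic (components θ c z))
      (extChartAt (𝓡 n).tangent c v) :=
    (FrolicherNijenhuis.semibasic (E := EuclideanSpace ℝ (Fin n))).differentiableAt.comp _
      h.differentiableAt
  rw [FrolicherNijenhuis.extD_eq h.mem_source
    (h.inChart_eq.differentiableAt_iff.2 (oneForm.differentiableAt.comp _ hd)),
    h.inChart_eq.extDeriv_eq, extDeriv_oneForm hd, fderiv_semibasic h.differentiableAt]

theorem extD_inner_eq_zero (h : SemibasicNear θ c v) {l : ℕ}
    {L : VForm (𝓡 n).tangent (TangentBundle (𝓡 n) M) l}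
    (hL : ∀ᶠ w in 𝓝 v, ∀ x, dProj M w (L w x) = 0) :
    extD (inner (k := 0) L θ) v = 0 := by
  refine extD_eq_zero ?_
  filter_upwards [h.semibasic, hL] with w hw hLw
  refine innerProd_eq_zero fun x y => ?_
  refine Eq.trans ?_ (hw _ (hLw x))
  congr 1
  funext i
  fin_cases i; rfl

/-- When `L` has vertical values near `v`, the form `i_L θ` vanishes there and `d_L θ` reduces to
`i_L dθ`. This covers `ℂ`, `J` and `R` at once. -/
theorem dWith_eq (h : SemibasicNear θ c v) {l : ℕ}
    {L : VForm (𝓡 n).tangent (TangentBundle (𝓡 n) M) l}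
    (hL : ∀ᶠ w in 𝓝 v, ∀ x, dProj M w (L w x) = 0)
    {L' : (EuclideanSpace ℝ (Fin n) × EuclideanSpace ℝ (Fin n)) [⋀^Fin l]→L[ℝ]
      (EuclideanSpace ℝ (Fin n) × EuclideanSpace ℝ (Fin n))}
    (hL' : ∀ x, dChart c v (L v x) = L' fun i => dChart c v (x i)) :
    dWith (k := 0) L θ v = (innerProd (k := 1) L' (skewForm (FrolicherNijenhuis.semibasic ∘L
      fderiv ℝ (components θ c) (extChartAt (𝓡 n).tangent c v)))).compContinuousLinearMap
        (dChart c v) := by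
  have h1 : dWith (k := 0) L θ v = innerProd (k := 1) (L v) (extD θ v) +
    (-1 : ℝ) ^ l • extD (inner (k := 0) L θ) v := rfl
  rw [h1, h.extD_inner_eq_zero hL, h.extD_eq, innerProd_compContinuousLinearMap hL']
  exact (congrArg _ (smul_zero _)).trans (add_zero _)

theorem lieLiouville_eq (h : SemibasicNear θ c v) :
    lieLiouville θ v = (oneForm (FrolicherNijenhuis.semibasic (fderiv ℝ (components θ c)
      (extChartAt (𝓡 n).tangent c v) (0, (extChartAt (𝓡 n).tangent c v).2)))
        ).compContinuousLinearMap (dChart c v) := by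
  refine (h.dWith_eq (l := 0) (L := (liouville M).toVForm) ?_ (L' :=
    ContinuousAlternatingMap.constOfIsEmpty ℝ _ (Fin 0)
      (0, (extChartAt (𝓡 n).tangent c v).2)) ?_).trans ?_
  · refine Filter.Eventually.of_forall fun w x => ?_
    rw [dProj_eq_zero_iff (mem_extChartAt_source w)]
    exact congrArg Prod.fst (dChart_liouville (mem_extChartAt_source w))
  · intro x
    exact dChart_liouville h.mem_source
  · congr 1
    refine ext_oneForm fun X => ?_
    rw [innerProd_constOfIsEmpty]
    simp

theorem dJ_eq (h : SemibasicNear θ c v) :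
    dJ θ v = (skewForm (FrolicherNijenhuis.semibasic ∘L fderiv ℝ (components θ c)
      (extChartAt (𝓡 n).tangent c v) ∘L ContinuousLinearMap.inr ℝ _ _ ∘L
        ContinuousLinearMap.fst ℝ _ _)).compContinuousLinearMap (dChart c v) := by
  refine (h.dWith_eq (l := 1) (L := EndField.toVForm (tangentStructure M)) ?_ (L' :=
    ContinuousAlternatingMap.ofSubsingleton ℝ _ _ (0 : Fin 1)
      (ContinuousLinearMap.inr ℝ _ _ ∘L ContinuousLinearMap.fst ℝ _ _)) ?_).trans ?_
  · refine Filter.Eventually.of_forall fun w x => ?_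
    rw [dProj_eq_zero_iff (mem_extChartAt_source w)]
    exact congrArg Prod.fst (dChart_tangentStructure (mem_extChartAt_source w) (x 0))
  · intro x
    exact dChart_tangentStructure h.mem_source (x 0)
  · congr 1
    refine ext_twoForm fun X Y => ?_
    rw [innerProd_ofSubsingleton_two]
    simp

variable {S : VField (𝓡 n).tangent (TangentBundle (𝓡 n) M)}

theorem inner_horizontal_eq (hS : IsSpray S) (hv : v ∈ slashed M) (h : IsSemibasicAt θ v) :
    inner (k := 0) (l := 1) (horizontal S).toVForm θ v = θ v := by
  refine ext_oneForm fun ξ => ?_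
  refine (innerProd_ofSubsingleton (horizontal S v) (θ v) ξ).trans ?_
  -- A vector and its horizontal part differ by a vertical vector, on which `θ` vanishes.
  have h1 : dProj M v (horizontal S v ξ - ξ) = 0 := by
    rw [dProj_eq_zero_iff (mem_extChartAt_source v), map_sub,
      dChart_horizontal hS (mem_extChartAt_source v) hv]
    simp
  have h2 := h _ h1
  have h3 : θ v ![horizontal S v ξ] = θ v ![horizontal S v ξ - ξ] + θ v ![ξ] := by
    refine Eq.trans ?_ ((θ v).cons_add ![] (horizontal S v ξ - ξ) ξ)
    rw [sub_add_cancel]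
    rfl
  rw [h3, h2, zero_add]

/-- Here `h` is not vertical: instead `i_h θ = θ` near `v`, so `d_h θ = i_h dθ - dθ`. Since `h`
preserves first components, the terms without `h` cancel. -/
theorem dh_eq (hS : IsSpray S) (hv : v ∈ slashed M) (h : SemibasicNear θ c v) :
    dh S θ v = (skewForm (FrolicherNijenhuis.semibasic ∘L fderiv ℝ (components θ c)
      (extChartAt (𝓡 n).tangent c v) ∘L
        graphProj (coeff S c (extChartAt (𝓡 n).tangent c v)))).compContinuousLinearMap
          (dChart c v) := by
  have h1 : dh S θ v = innerProd (k := 1) ((horizontal S).toVForm v) (extD θ v) +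
    (-1 : ℝ) ^ 1 • extD (inner (k := 0) (l := 1) (horizontal S).toVForm θ) v := rfl
  have h2 : extD (inner (k := 0) (l := 1) (horizontal S).toVForm θ) v = extD θ v := by
    refine extD_congr (k := 1) ?_
    filter_upwards [h.semibasic, isOpen_slashed.mem_nhds hv] with w hw hw'
    exact inner_horizontal_eq hS hw' hw
  have h3 : ∀ x : Fin 1 → TangentSpace (𝓡 n).tangent v,
      dChart c v ((horizontal S).toVForm v x) = ContinuousAlternatingMap.ofSubsingleton ℝ _ _
        (0 : Fin 1) (graphProj (coeff S c (extChartAt (𝓡 n).tangent c v)))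
          fun i => dChart c v (x i) := fun x => dChart_horizontal hS h.mem_source hv (x 0)
  rw [h1, h2, h.extD_eq, innerProd_compContinuousLinearMap h3]
  refine ext_twoForm fun ξ η => ?_
  generalize fderiv ℝ (components θ c) (extChartAt (𝓡 n).tangent c v) = T
  generalize coeff S c (extChartAt (𝓡 n).tangent c v) = m
  have e : ∀ β : (EuclideanSpace ℝ (Fin n) × EuclideanSpace ℝ (Fin n)) [⋀^Fin 2]→L[ℝ] ℝ,
      β.compContinuousLinearMap (dChart c v) ![ξ, η] = β ![dChart c v ξ, dChart c v η] := by
    intro β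
    change β _ = _
    congr 1
    funext i
    fin_cases i <;> rfl
  refine Eq.trans (b := _ + (-1 : ℝ) ^ 1 * _) rfl ?_
  refine Eq.trans (congrArg₂ (fun a b => a + (-1 : ℝ) ^ 1 * b) (e _) (e _)) ?_
  rw [e, innerProd_ofSubsingleton_two]
  simp
  ring

/-- In `i_R dθ`, each cyclic term `dθ (R (X, Y), Z)` loses one half, because the semi-basic slot
kills the vertical vector `R (X, Y)`. -/
theorem dR_eq_zero_iff (hS : IsSpray S) (hv : v ∈ slashed M) (h : SemibasicNear θ v v) :
    dR S θ v = 0 ↔ ∀ a b c,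
      fderiv ℝ (components θ v) (extChartAt (𝓡 n).tangent v v)
        (0, curvatureCoeff (coeff S v) (extChartAt (𝓡 n).tangent v v) a b) c +
      fderiv ℝ (components θ v) (extChartAt (𝓡 n).tangent v v)
        (0, curvatureCoeff (coeff S v) (extChartAt (𝓡 n).tangent v v) b c) a +
      fderiv ℝ (components θ v) (extChartAt (𝓡 n).tangent v v)
        (0, curvatureCoeff (coeff S v) (extChartAt (𝓡 n).tangent v v) c a) b = 0 := by
  have hd := extChartAt_mem_domain (mem_extChartAt_source v) hv
  have hk := (contDiffAt_coeff hS hd).differentiableAt (by simp)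
  have h1 : dR S θ v = _ := h.dWith_eq (l := 2) (L := curvature S) (by
    filter_upwards [isOpen_slashed.mem_nhds hv] with w hw x using dProj_curvature hS hw x)
    (L' := (1 / 2 : ℝ) • fnBracket (fun y => graphProj (coeff S v y))
      (fun y => graphProj (coeff S v y)) (extChartAt (𝓡 n).tangent v v))
    (dChart_curvature hS hv)
  rw [h1]
  generalize fderiv ℝ (components θ v) (extChartAt (𝓡 n).tangent v v) = T
  have e1 : ∀ X Y, ((1 / 2 : ℝ) • fnBracket (fun y => graphProj (coeff S v y))
      (fun y => graphProj (coeff S v y)) (extChartAt (𝓡 n).tangent v v)) ![X, Y] =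
      (0, curvatureCoeff (coeff S v) (extChartAt (𝓡 n).tangent v v) X.1 Y.1) := by
    intro X Y
    rw [ContinuousAlternatingMap.smul_apply, fnBracket_graphProj hk, smul_smul]
    norm_num
    rfl
  have key : ∀ X Y Z, innerProd (k := 1) (l := 2)
      ((1 / 2 : ℝ) • fnBracket (fun y => graphProj (coeff S v y))
      (fun y => graphProj (coeff S v y)) (extChartAt (𝓡 n).tangent v v))
      (skewForm (FrolicherNijenhuis.semibasic ∘L T)) ![X, Y, Z] =
      T (0, curvatureCoeff (coeff S v) (extChartAt (𝓡 n).tangent v v) X.1 Y.1) Z.1 +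
      T (0, curvatureCoeff (coeff S v) (extChartAt (𝓡 n).tangent v v) Y.1 Z.1) X.1 +
      T (0, curvatureCoeff (coeff S v) (extChartAt (𝓡 n).tangent v v) Z.1 X.1) Y.1 := by
    intro X Y Z
    rw [innerProd_two_two]
    simp only [e1, skewForm_apply]
    simp
  rw [compContinuousLinearMap_eq_zero_iff (dChart_surjective (mem_extChartAt_source v))]
  refine ⟨fun h0 a b c => ?_, fun h0 => ext_threeForm fun X Y Z => (key X Y Z).trans (h0 _ _ _)⟩
  exact (key (a, 0) (b, 0) (c, 0)).symm.trans (DFunLike.congr_fun h0 _)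

end SemibasicNear

end Spray

/-! ### Linear algebra of first and second order solutions. -/

namespace Spray

open FrolicherNijenhuis

section Algebra

variable {E : Type*} [NormedAddCommGroup E] [NormedSpace ℝ E]

/-- The equations `P₁ θ = 0` at a point, where `T` is the derivative of the components of `θ`,
`m` gives the horizontal subspace and `y` is the fibre coordinate. -/
structure FirstOrder (T : E × E →L[ℝ] E →L[ℝ] ℝ) (m : E →L[ℝ] E) (y : E) : Prop where
  liouville : T (0, y) = 0
  vertical : ∀ a b, T (0, a) b = T (0, b) a
  horizontal : ∀ a b, T (a, m a) b = T (b, m b) a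

/-- The derivatives of the equations `P₁ θ = 0` at a point, where `T` and `U` are the first
and second derivatives of the components of `θ`, and `K` is the derivative of `m`. -/
structure SecondOrder (T : E × E →L[ℝ] E →L[ℝ] ℝ) (U : E × E →L[ℝ] E × E →L[ℝ] E →L[ℝ] ℝ)
    (m : E →L[ℝ] E) (K : E × E →L[ℝ] E →L[ℝ] E) (y : E) : Prop where
  liouville : ∀ X, U X (0, y) + T (0, X.2) = 0
  vertical : ∀ X a b, U X (0, a) b = U X (0, b) a
  horizontal : ∀ X a b,
    U X (a, m a) b + T (0, K X a) b = U X (b, m b) a + T (0, K X b) a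

/-- The obstruction `d_R θ` to the existence of second order solutions. -/
def Integrable (T : E × E →L[ℝ] E →L[ℝ] ℝ) (m : E →L[ℝ] E) (K : E × E →L[ℝ] E →L[ℝ] E) : Prop :=
  ∀ a b c, T (0, K (a, m a) b - K (b, m b) a) c + T (0, K (b, m b) c - K (c, m c) b) a +
    T (0, K (c, m c) a - K (a, m a) c) b = 0

theorem zero_sub_pair {E : Type*} [AddCommGroup E] (x y : E) :
    ((0 : E), x - y) = (0, x) - (0, y) := by
  simp

theorem zero_add_pair {E : Type*} [AddCommGroup E] (x y : E) :
    ((0 : E), x + y) = (0, x) + (0, y) := by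
  simp

theorem zero_smul_pair (c : ℝ) (y : E) : ((0 : E), c • y) = c • (0, y) := by simp

/-- Take the horizontal equation with `X` the horizontal lift of one of three vectors and sum
cyclically: by symmetry of `U` every second-order term occurs on both sides, leaving the curvature
terms in `T`. -/
theorem SecondOrder.integrable {T : E × E →L[ℝ] E →L[ℝ] ℝ}
    {U : E × E →L[ℝ] E × E →L[ℝ] E →L[ℝ] ℝ} {m : E →L[ℝ] E} {K : E × E →L[ℝ] E →L[ℝ] E} {y : E}
    (h : SecondOrder T U m K y) (hU : ∀ X Y, U X Y = U Y X) : Integrable T m K := by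
  intro a b c
  have h1 := h.horizontal (a, m a) b c
  have h2 := h.horizontal (b, m b) c a
  have h3 := h.horizontal (c, m c) a b
  rw [hU (b, m b) (a, m a)] at h2
  rw [hU (c, m c) (b, m b), hU (c, m c) (a, m a)] at h3
  simp only [zero_sub_pair, map_sub, sub_apply]
  linarith

theorem exists_clm_of_isLinearMap {V G : Type*} [NormedAddCommGroup V] [NormedSpace ℝ V]
    [FiniteDimensional ℝ V] [NormedAddCommGroup G] [NormedSpace ℝ G] {f : V → G}
    (h1 : ∀ x y, f (x + y) = f x + f y) (h2 : ∀ (c : ℝ) x, f (c • x) = c • f x) :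
    ∃ g : V →L[ℝ] G, ∀ x, g x = f x :=
  ⟨((IsLinearMap.mk h1 h2).mk' f).toContinuousLinearMap, fun _ => rfl⟩

/-- Continuity is automatic in finite dimension, so the map can be assembled one slot at a time. -/
theorem exists_clm_of_trilinear [FiniteDimensional ℝ E] (τ : E × E → E × E → E → ℝ)
    (h1 : ∀ Y a, IsLinearMap ℝ fun X => τ X Y a) (h2 : ∀ X a, IsLinearMap ℝ fun Y => τ X Y a)
    (h3 : ∀ X Y, IsLinearMap ℝ fun a => τ X Y a) :
    ∃ U : E × E →L[ℝ] E × E →L[ℝ] E →L[ℝ] ℝ, ∀ X Y a, U X Y a = τ X Y a := by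
  let f3 : E × E → E × E → E →L[ℝ] ℝ := fun X Y => ((h3 X Y).mk' _).toContinuousLinearMap
  have e3 : ∀ X Y a, f3 X Y a = τ X Y a := fun X Y a => rfl
  have l2 : ∀ X, IsLinearMap ℝ (f3 X) := fun X =>
    ⟨fun Y Y' => by ext a; simpa [e3] using (h2 X a).map_add Y Y',
      fun c Y => by ext a; simpa [e3] using (h2 X a).map_smul c Y⟩
  let f2 : E × E → E × E →L[ℝ] E →L[ℝ] ℝ := fun X => ((l2 X).mk' _).toContinuousLinearMap
  have e2 : ∀ X Y, f2 X Y = f3 X Y := fun X Y => rfl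
  have l1 : IsLinearMap ℝ f2 :=
    ⟨fun X X' => ContinuousLinearMap.ext fun Y => by
      ext a; simpa [e2, e3] using (h1 Y a).map_add X X',
      fun c X => ContinuousLinearMap.ext fun Y => by
        ext a; simpa [e2, e3] using (h1 Y a).map_smul c X⟩
  obtain ⟨f1, e1⟩ := exists_clm_of_isLinearMap (V := E × E)
    (G := E × E →L[ℝ] E →L[ℝ] ℝ) (f := f2) l1.map_add l1.map_smul
  exact ⟨f1, fun X Y a => by rw [e1, e2, e3]⟩

/-- With `X = (X.1, m X.1) + (0, v X)`, the form `U` consists of a vertical block `C`, a mixed block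
`D` and a horizontal block `Q`, and the equations can be solved block by block. Only `Q` uses `h`.
-/
theorem Integrable.exists_secondOrder [FiniteDimensional ℝ E] {T : E × E →L[ℝ] E →L[ℝ] ℝ}
    {m : E →L[ℝ] E} {K : E × E →L[ℝ] E →L[ℝ] E} {y : E}
    (h : Integrable T m K) (hT : FirstOrder T m y) (hy : y ≠ 0)
    (hK : ∀ a b, K (0, a) b = K (0, b) a) (hKy : ∀ b, K (0, b) y = m b) :
    ∃ U : E × E →L[ℝ] E × E →L[ℝ] E →L[ℝ] ℝ, (∀ X Y, U X Y = U Y X) ∧ SecondOrder T U m K y := by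
  -- This is where `y ≠ 0` enters: the Liouville equation prescribes `C` when one argument is `y`,
  -- and `l` extends that value to all arguments.
  obtain ⟨l, hl⟩ : ∃ l : E →L[ℝ] ℝ, l y = 1 := by
    obtain ⟨l, hl⟩ := SeparatingDual.exists_eq_one (R := ℝ) hy
    exact ⟨l, hl⟩
  let w : E → E → ℝ := fun a b => T (0, a) b
  have w_symm : ∀ a b, w a b = w b a := hT.vertical
  have w_add : ∀ a a' b, w (a + a') b = w a b + w a' b := fun a a' b => by
    simp only [w, zero_add_pair, map_add, add_apply]
  have w_smul : ∀ (c : ℝ) a b, w (c • a) b = c * w a b := fun c a b => by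
    simp only [w, zero_smul_pair, map_smul, smul_apply, smul_eq_mul]
  have w_add' : ∀ a b b', w a (b + b') = w a b + w a b' := fun a b b' => by simp [w]
  have w_smul' : ∀ (c : ℝ) a b, w a (c • b) = c * w a b := fun c a b => by simp [w]
  have w_y : ∀ b, w y b = 0 := fun b => by simp [w, hT.liouville]
  let v : E × E → E := fun X => X.2 - m X.1
  have v_add : ∀ X Y, v (X + Y) = v X + v Y := fun X Y => by simp [v]; abel
  have v_smul : ∀ (c : ℝ) X, v (c • X) = c • v X := fun c X => by simp [v, smul_sub]
  -- The derivative of the connection coefficients is split into a horizontal part `Hm` and a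
  -- vertical part `V`.
  let Hm : E → E → E := fun c a => K (c, m c) a
  have H_add : ∀ c c' a, Hm (c + c') a = Hm c a + Hm c' a := fun c c' a => by
    have : (c + c', m (c + c')) = (c, m c) + (c', m c') := by simp
    change K (c + c', m (c + c')) a = _
    rw [this, map_add]
    rfl
  have H_smul : ∀ (r : ℝ) c a, Hm (r • c) a = r • Hm c a := fun r c a => by
    have : (r • c, m (r • c)) = r • (c, m c) := by simp
    change K (r • c, m (r • c)) a = _
    rw [this, map_smul]
    rfl
  have H_add' : ∀ c a a', Hm c (a + a') = Hm c a + Hm c a' := fun c a a' => by simp [Hm]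
  have H_smul' : ∀ (r : ℝ) c a, Hm c (r • a) = r • Hm c a := fun r c a => by simp [Hm]
  let V : E → E → E := fun b a => K (0, b) a
  have V_symm : ∀ a b, V a b = V b a := hK
  have V_add : ∀ c c' a, V (c + c') a = V c a + V c' a := fun c c' a => by
    simp only [V, zero_add_pair, map_add, add_apply]
  have V_smul : ∀ (r : ℝ) c a, V (r • c) a = r • V c a := fun r c a => by
    simp only [V, zero_smul_pair, map_smul, smul_apply]
  have V_add' : ∀ c a a', V c (a + a') = V c a + V c a' := fun c a a' => by simp [V]
  have V_smul' : ∀ (r : ℝ) c a, V c (r • a) = r • V c a := fun r c a => by simp [V]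
  have hint : ∀ a b c, w (Hm a b) c - w (Hm b a) c + (w (Hm b c) a - w (Hm c b) a) +
      (w (Hm c a) b - w (Hm a c) b) = 0 := fun a b c => by
    have := h a b c
    simpa only [zero_sub_pair, map_sub, sub_apply] using this
  have K_split : ∀ X a, K X a = Hm X.1 a + V (v X) a := fun X a => by
    have : X = (X.1, m X.1) + (0, v X) := by simp [v]
    conv_lhs => rw [this]
    simp only [map_add, add_apply, Hm, V]
  -- Totally symmetric, as the vertical equation and the symmetry of `U` demand. Putting `y` in one
  -- slot leaves `-w` of the other two, since `w` vanishes on `y`.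
  let C : E → E → E → ℝ := fun b c a => -(l a * w b c + l b * w a c + l c * w b a)
  -- The first term cancels `T (0, K X a) b` for vertical `X`. The second makes `D` symmetric in the
  -- two fibre slots, and the symmetry of `V` keeps the horizontal equation true.
  let D : E → E → E → ℝ := fun a b c => -(w (V b a) c + w (V c a) b)
  -- `Q` must be symmetric in `c`, `a`, with its skew part in `a`, `b` prescribed by the horizontal
  -- equation. Summing two instances of the prescribed skew part gives that symmetry. The skew part
  -- of the sum is three times the required one modulo the cyclic identity, hence the `1 / 3`.
  let Q : E → E → E → ℝ := fun c a b =>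
    (1 / 3) * (w (Hm c b) a - w (Hm c a) b + (w (Hm a b) c - w (Hm a c) b))
  let τ : E × E → E × E → E → ℝ := fun X Y a =>
    C (v X) (v Y) a + D X.1 (v Y) a + D Y.1 (v X) a + Q X.1 Y.1 a
  obtain ⟨U, hU⟩ := exists_clm_of_trilinear τ
    (fun Y a => ⟨fun X X' => by
        simp only [τ, C, D, Q, v_add, Prod.fst_add, w_add, w_add', V_add, V_add', H_add, H_add',
          map_add]
        ring,
      fun c X => by
        simp only [τ, C, D, Q, v_smul, Prod.smul_fst, w_smul, w_smul', V_smul, V_smul', H_smul,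
          H_smul', map_smul, smul_eq_mul]
        ring⟩)
    (fun X a => ⟨fun Y Y' => by
        simp only [τ, C, D, Q, v_add, Prod.fst_add, w_add, w_add', V_add, V_add', H_add, H_add',
          map_add]
        ring,
      fun c Y => by
        simp only [τ, C, D, Q, v_smul, Prod.smul_fst, w_smul, w_smul', V_smul, V_smul', H_smul,
          H_smul', map_smul, smul_eq_mul]
        ring⟩)
    (fun X Y => ⟨fun a a' => by
        simp only [τ, C, D, Q, w_add, w_add', V_add, H_add', map_add]
        ring,
      fun c a => by
        simp only [τ, C, D, Q, w_smul, w_smul', V_smul, H_smul', map_smul, smul_eq_mul]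
        ring⟩)
  have v_vert : ∀ a, v (0, a) = a := fun a => by simp [v]
  have v_hor : ∀ a, v (a, m a) = 0 := fun a => by simp [v]
  have w_zero : ∀ b, w 0 b = 0 := fun b => by simpa using w_smul 0 0 b
  have w_zero' : ∀ b, w b 0 = 0 := fun b => by simp [w]
  have V_zero : ∀ b, V 0 b = 0 := fun b => by simpa using V_smul 0 0 b
  have V_zero' : ∀ b, V b 0 = 0 := fun b => by simp [V]
  have H_zero : ∀ b, Hm 0 b = 0 := fun b => by simpa using H_smul 0 0 b
  have H_zero' : ∀ b, Hm b 0 = 0 := fun b => by simp [Hm]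
  refine ⟨U, fun X Y => ?_, fun X => ?_, fun X a b => ?_, fun X a b => ?_⟩
  · ext a
    simp only [hU, τ, C, D, Q]
    rw [w_symm (v Y) (v X), w_symm (v Y) a, w_symm (v X) a]
    ring
  · ext a
    have e : w X.2 a = w (v X) a + w (m X.1) a := by
      rw [← w_add]
      congr 1
      simp [v]
    change U X (0, y) a + w X.2 a = 0
    rw [hU]
    simp only [τ, C, D, Q, v_vert, V_zero', w_zero, w_zero', H_zero', H_zero, e]
    -- The mixed block yields `-w (m X.1) a` by homogeneity (`hKy`), the vertical block `-w (v X)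
    -- a`; together they cancel `w X.2 a`.
    rw [w_symm (v X) y, w_symm a y, V_symm y, show V X.1 y = m X.1 from hKy _, w_y, w_y,
      w_symm (V a X.1) y, w_y, hl]
    ring
  · simp only [hU, τ, C, D, Q, v_vert, V_zero', w_zero, w_zero', H_zero', H_zero]
    rw [w_symm a b]
    ring
  · change U X (a, m a) b + w (K X a) b = U X (b, m b) a + w (K X b) a
    simp only [hU, τ, C, D, Q, v_hor, V_zero, w_zero, w_zero', map_zero, K_split, w_add]
    -- The cyclic identity settles the horizontal block; the mixed terms match by the symmetry of
    -- `V`.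
    have h1 := hint X.1 a b
    have h2 := hint a b X.1
    have h3 := V_symm a b
    rw [h3]
    linarith

end Algebra

end Spray

/-! ### Jets of order at most one and vanishing criteria. -/

namespace FrolicherNijenhuis

variable {F : Type*} [NormedAddCommGroup F] [NormedSpace ℝ F] {H : Type*} [TopologicalSpace H]
  {I : ModelWithCorners ℝ F H} {N : Type*} [TopologicalSpace N] [ChartedSpace H N]

theorem Form.sameJet_zero_iff {k : ℕ} {α β : Form I N k} {x : N} :
    α.SameJet 0 x β ↔ α.inChart x (extChartAt I x x) = β.inChart x (extChartAt I x x) := by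
  constructor
  · intro h
    have := DFunLike.congr_fun (h 0 le_rfl) 0
    simpa using this
  · intro h i hi
    obtain rfl := Nat.le_zero.1 hi
    ext1 v
    simpa using h

theorem Form.sameJet_one_iff {k : ℕ} {α β : Form I N k} {x : N} :
    α.SameJet 1 x β ↔ α.inChart x (extChartAt I x x) = β.inChart x (extChartAt I x x) ∧
      fderiv ℝ (α.inChart x) (extChartAt I x x) = fderiv ℝ (β.inChart x) (extChartAt I x x) := by
  constructor
  · intro h
    refine ⟨Form.sameJet_zero_iff.1 fun i hi => h i (hi.trans zero_le_one), ?_⟩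
    ext1 v
    have := DFunLike.congr_fun (h 1 le_rfl) fun _ => v
    simpa [iteratedFDeriv_one_apply] using this
  · rintro ⟨h0, h1⟩ i hi
    obtain rfl | rfl : i = 0 ∨ i = 1 := by omega
    · exact Form.sameJet_zero_iff.2 h0 0 le_rfl
    · ext1 v
      simp only [iteratedFDeriv_one_apply, h1]

theorem Form.inChart_zero {k : ℕ} (x : N) : (0 : Form I N k).inChart x = 0 := rfl

theorem oneForm_eq_zero_iff {E : Type*} [NormedAddCommGroup E] [NormedSpace ℝ E]
    {f : E →L[ℝ] ℝ} : oneForm (semibasic f) = 0 ↔ f = 0 := by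
  constructor
  · intro h
    ext a
    exact DFunLike.congr_fun h ![(a, 0)]
  · rintro rfl
    simp

theorem skewForm_eq_zero_iff {b : F →L[ℝ] F →L[ℝ] ℝ} :
    skewForm b = 0 ↔ ∀ X Y, b X Y = b Y X := by
  constructor
  · intro h X Y
    have := DFunLike.congr_fun h ![X, Y]
    rw [skewForm_apply] at this
    exact sub_eq_zero.1 this
  · intro h
    refine ext_twoForm fun X Y => ?_
    rw [skewForm_apply, h, sub_self]
    rfl

end FrolicherNijenhuis

/-! ### The jets of `P₁ θ` as equations on the derivatives of the components. -/

namespace Spray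

open FrolicherNijenhuis

section Model

variable {E : Type*} [NormedAddCommGroup E] [NormedSpace ℝ E]

theorem hasFDerivAt_liouvilleEq {t : E × E → E →L[ℝ] ℝ} {z : E × E}
    (ht : DifferentiableAt ℝ (fderiv ℝ t) z) :
    ∃ D : E × E →L[ℝ] (E × E) [⋀^Fin 1]→L[ℝ] ℝ,
      HasFDerivAt (fun w => oneForm (semibasic (fderiv ℝ t w (0, w.2)))) D z ∧
      ∀ X, D X = oneForm (semibasic (fderiv ℝ (fderiv ℝ t) z X (0, z.2) +
        fderiv ℝ t z (0, X.2))) := by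
  have h4 : HasFDerivAt (fun z : E × E => ((0 : E), z.2)) ((0 : E × E →L[ℝ] E).prod
      (ContinuousLinearMap.snd ℝ _ _)) z :=
    (hasFDerivAt_const _ _).prodMk hasFDerivAt_snd
  have h1 := ht.hasFDerivAt.clm_apply h4
  have h2 := (oneForm (F := E × E)).hasFDerivAt.comp z
    ((semibasic (E := E)).hasFDerivAt.comp z h1)
  refine ⟨_, h2, fun X => ?_⟩
  simp [add_comm]

theorem hasFDerivAt_skewEq {t : E × E → E →L[ℝ] ℝ} {A : E × E → (E × E →L[ℝ] E × E)} {z : E × E}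
    (ht : DifferentiableAt ℝ (fderiv ℝ t) z) (hA : DifferentiableAt ℝ A z) :
    ∃ D : E × E →L[ℝ] (E × E) [⋀^Fin 2]→L[ℝ] ℝ,
      HasFDerivAt (fun w => skewForm (semibasic ∘L fderiv ℝ t w ∘L A w)) D z ∧
      ∀ X, D X = skewForm (semibasic ∘L (fderiv ℝ (fderiv ℝ t) z X ∘L A z +
        fderiv ℝ t z ∘L fderiv ℝ A z X)) := by
  have h1 := ht.hasFDerivAt.clm_comp hA.hasFDerivAt
  have h2 := (hasFDerivAt_const (semibasic (E := E)) z).clm_comp h1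
  have h3 := (skewForm (F := E × E)).hasFDerivAt.comp z h2
  refine ⟨_, h3, fun X => ?_⟩
  change skewForm _ = skewForm _
  congr 1
  refine ContinuousLinearMap.ext fun Y => ?_
  refine ContinuousLinearMap.ext fun Z => ?_
  simp [add_comm]

end Model

variable {n : ℕ} {M : Type*} [TopologicalSpace M] [ChartedSpace (EuclideanSpace ℝ (Fin n)) M]
  [IsManifold (𝓡 n) ∞ M]
  {S : VField (𝓡 n).tangent (TangentBundle (𝓡 n) M)} {u : TangentBundle (𝓡 n) M}

/-- Passes from pointwise formulas at all points near `u` to an identity of germs in the fixed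
chart, which may then be differentiated. -/
theorem eventually_inChart {k : ℕ} {α : Form (𝓡 n).tangent (TangentBundle (𝓡 n) M) k}
    {β : EuclideanSpace ℝ (Fin n) × EuclideanSpace ℝ (Fin n) →
      (EuclideanSpace ℝ (Fin n) × EuclideanSpace ℝ (Fin n)) [⋀^Fin k]→L[ℝ] ℝ}
    (h : ∀ᶠ v in 𝓝 u, α v =
      (β (extChartAt (𝓡 n).tangent u v)).compContinuousLinearMap (dChart u v)) :
    α.inChart u =ᶠ[𝓝 (extChartAt (𝓡 n).tangent u u)] β := by
  filter_upwards [eventually_mem_target_inter (I := (𝓡 n).tangent) u h] with z hz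
  refine Form.inChart_eq hz.1 ?_
  have := hz.2
  rw [(extChartAt (𝓡 n).tangent u).right_inv hz.1] at this
  exact this

theorem inChart_lieLiouville (θ : LocalSection u) :
    (lieLiouville θ.1).inChart u =ᶠ[𝓝 (extChartAt (𝓡 n).tangent u u)]
      fun z => oneForm (semibasic (fderiv ℝ (components θ.1 u) z (0, z.2))) := by
  refine eventually_inChart ?_
  filter_upwards [θ.eventually_semibasicNear] with v hv using hv.lieLiouville_eq

theorem inChart_dJ (θ : LocalSection u) :
    (dJ θ.1).inChart u =ᶠ[𝓝 (extChartAt (𝓡 n).tangent u u)]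
      fun z => skewForm (semibasic ∘L fderiv ℝ (components θ.1 u) z ∘L
        ContinuousLinearMap.inr ℝ _ _ ∘L ContinuousLinearMap.fst ℝ _ _) := by
  refine eventually_inChart (k := 2) ?_
  filter_upwards [θ.eventually_semibasicNear] with v hv using hv.dJ_eq

theorem inChart_dh (hS : IsSpray S) (hu : u ∈ slashed M) (θ : LocalSection u) :
    (dh S θ.1).inChart u =ᶠ[𝓝 (extChartAt (𝓡 n).tangent u u)]
      fun z => skewForm (semibasic ∘L fderiv ℝ (components θ.1 u) z ∘L
        graphProj (coeff S u z)) := by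
  refine eventually_inChart (k := 2) ?_
  filter_upwards [θ.eventually_semibasicNear, isOpen_slashed.mem_nhds hu] with v hv hv'
    using hv.dh_eq hS hv'

/-- Only the first derivative of the components enters, because coefficient derivatives do not occur
in the coordinate form of `P₁`. -/
theorem jetP1Vanishes_zero_iff (hS : IsSpray S) (hu : u ∈ slashed M) (θ : LocalSection u) :
    JetP1Vanishes S 0 u θ.1 ↔
      FirstOrder (fderiv ℝ (components θ.1 u) (extChartAt (𝓡 n).tangent u u))
        (coeff S u (extChartAt (𝓡 n).tangent u u)) (extChartAt (𝓡 n).tangent u u).2 := by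
  rw [JetP1Vanishes, Form.sameJet_zero_iff, Form.sameJet_zero_iff, Form.sameJet_zero_iff,
    (inChart_lieLiouville θ).self_of_nhds, (inChart_dJ θ).self_of_nhds,
    (inChart_dh hS hu θ).self_of_nhds, Form.inChart_zero, Form.inChart_zero]
  simp only [Pi.zero_apply]
  erw [oneForm_eq_zero_iff, skewForm_eq_zero_iff, skewForm_eq_zero_iff]
  constructor
  · rintro ⟨h1, h2, h3⟩
    exact ⟨h1, fun a b => h2 (a, 0) (b, 0), fun a b => h3 (a, 0) (b, 0)⟩
  · rintro ⟨h1, h2, h3⟩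
    exact ⟨h1, fun X Y => h2 X.1 Y.1, fun X Y => h3 X.1 Y.1⟩

/-- Obtained by differentiating the three coordinate expressions. The moving coefficients `y` and
`m` contribute the terms in `T`, while `J` is constant and contributes none. -/
theorem jetP1Vanishes_one_iff (hS : IsSpray S) (hu : u ∈ slashed M) (θ : LocalSection u) :
    JetP1Vanishes S 1 u θ.1 ↔ JetP1Vanishes S 0 u θ.1 ∧
      SecondOrder (fderiv ℝ (components θ.1 u) (extChartAt (𝓡 n).tangent u u))
        (fderiv ℝ (fderiv ℝ (components θ.1 u)) (extChartAt (𝓡 n).tangent u u))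
        (coeff S u (extChartAt (𝓡 n).tangent u u))
        (fderiv ℝ (coeff S u) (extChartAt (𝓡 n).tangent u u))
        (extChartAt (𝓡 n).tangent u u).2 := by
  have hd := extChartAt_mem_domain (mem_extChartAt_source u) hu
  have ht : DifferentiableAt ℝ (fderiv ℝ (components θ.1 u)) (extChartAt (𝓡 n).tangent u u) :=
    ((θ.eventually_contDiffAt.self_of_nhds).fderiv_right (m := ∞) (by simp)).differentiableAt
      (by simp)
  obtain ⟨dg, hg⟩ := hasFDerivAt_graphProj ((contDiffAt_coeff hS hd).differentiableAt (by simp))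
  obtain ⟨D1, hD1, e1⟩ := hasFDerivAt_liouvilleEq ht
  obtain ⟨D2, hD2, e2⟩ := hasFDerivAt_skewEq ht (A := fun _ =>
    ContinuousLinearMap.inr ℝ _ _ ∘L ContinuousLinearMap.fst ℝ _ _) (differentiableAt_const _)
  obtain ⟨D3, hD3, e3⟩ := hasFDerivAt_skewEq ht dg
  have f1 := (inChart_lieLiouville θ).fderiv_eq.trans hD1.fderiv
  have f2 := (inChart_dJ θ).fderiv_eq.trans hD2.fderiv
  have f3 := (inChart_dh hS hu θ).fderiv_eq.trans hD3.fderiv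
  have z1 : ∀ k, fderiv ℝ ((0 : Form (𝓡 n).tangent (TangentBundle (𝓡 n) M) k).inChart u)
      (extChartAt (𝓡 n).tangent u u) = 0 := fun k => by
    rw [Form.inChart_zero]
    exact fderiv_const_apply _
  have q1 : fderiv ℝ ((lieLiouville θ.1).inChart u) (extChartAt (𝓡 n).tangent u u) =
      fderiv ℝ ((0 : Form (𝓡 n).tangent (TangentBundle (𝓡 n) M) 1).inChart u)
        (extChartAt (𝓡 n).tangent u u) ↔ ∀ X,
      fderiv ℝ (fderiv ℝ (components θ.1 u)) (extChartAt (𝓡 n).tangent u u) X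
        (0, (extChartAt (𝓡 n).tangent u u).2) +
        fderiv ℝ (components θ.1 u) (extChartAt (𝓡 n).tangent u u) (0, X.2) = 0 := by
    rw [z1, f1, ContinuousLinearMap.ext_iff]
    refine forall_congr' fun X => ?_
    rw [e1]
    exact oneForm_eq_zero_iff
  have q2 : fderiv ℝ ((dJ θ.1).inChart u) (extChartAt (𝓡 n).tangent u u) =
      fderiv ℝ ((0 : Form (𝓡 n).tangent (TangentBundle (𝓡 n) M) 2).inChart u)
        (extChartAt (𝓡 n).tangent u u) ↔ ∀ X a b,
      fderiv ℝ (fderiv ℝ (components θ.1 u)) (extChartAt (𝓡 n).tangent u u) X (0, a) b =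
        fderiv ℝ (fderiv ℝ (components θ.1 u)) (extChartAt (𝓡 n).tangent u u) X (0, b) a := by
    rw [z1, f2, ContinuousLinearMap.ext_iff]
    refine forall_congr' fun X => ?_
    rw [e2]
    refine skewForm_eq_zero_iff.trans ?_
    simp only [fderiv_fun_const]
    constructor
    · intro h a b
      simpa using h (a, 0) (b, 0)
    · intro h X Y
      simpa using h X.1 Y.1
  have q3 : fderiv ℝ ((dh S θ.1).inChart u) (extChartAt (𝓡 n).tangent u u) =
      fderiv ℝ ((0 : Form (𝓡 n).tangent (TangentBundle (𝓡 n) M) 2).inChart u)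
        (extChartAt (𝓡 n).tangent u u) ↔ ∀ X a b,
      fderiv ℝ (fderiv ℝ (components θ.1 u)) (extChartAt (𝓡 n).tangent u u) X
          (a, coeff S u (extChartAt (𝓡 n).tangent u u) a) b +
        fderiv ℝ (components θ.1 u) (extChartAt (𝓡 n).tangent u u)
          (0, fderiv ℝ (coeff S u) (extChartAt (𝓡 n).tangent u u) X a) b =
      fderiv ℝ (fderiv ℝ (components θ.1 u)) (extChartAt (𝓡 n).tangent u u) X
          (b, coeff S u (extChartAt (𝓡 n).tangent u u) b) a +
        fderiv ℝ (components θ.1 u) (extChartAt (𝓡 n).tangent u u)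
          (0, fderiv ℝ (coeff S u) (extChartAt (𝓡 n).tangent u u) X b) a := by
    rw [z1, f3, ContinuousLinearMap.ext_iff]
    refine forall_congr' fun X => ?_
    rw [e3]
    refine skewForm_eq_zero_iff.trans ?_
    generalize extChartAt (𝓡 n).tangent u u = z at hg ⊢
    constructor
    · intro h a b
      have := h (a, 0) (b, 0)
      simpa [hg] using this
    · intro h X Y
      simpa [hg] using h X.1 Y.1
  simp only [JetP1Vanishes, Form.sameJet_one_iff, Form.sameJet_zero_iff]
  constructor
  · rintro ⟨⟨a1, b1⟩, ⟨a2, b2⟩, a3, b3⟩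
    exact ⟨⟨a1, a2, a3⟩, q1.1 b1, q2.1 b2, q3.1 b3⟩
  · rintro ⟨⟨a1, a2, a3⟩, b1, b2, b3⟩
    exact ⟨⟨a1, q1.2 b1⟩, ⟨a2, q2.2 b2⟩, a3, q3.2 b3⟩

end Spray

/-! ### Sections with prescribed second derivative, and the lifting criterion. -/

namespace Spray

open FrolicherNijenhuis

section Model

variable {F G : Type*} [NormedAddCommGroup F] [NormedSpace ℝ F] [NormedAddCommGroup G]
  [NormedSpace ℝ G]

theorem hasFDerivAt_half_quadratic {B : F →L[ℝ] F →L[ℝ] G} (hB : ∀ X Y, B X Y = B Y X)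
    (z₀ z : F) : HasFDerivAt (fun z => (1 / 2 : ℝ) • B (z - z₀) (z - z₀)) (B (z - z₀)) z := by
  have h1 : HasFDerivAt (fun z : F => z - z₀) (ContinuousLinearMap.id ℝ F) z :=
    (hasFDerivAt_id z).sub_const z₀
  have h2 := ((B.hasFDerivAt.comp z h1).clm_apply h1).const_smul (1 / 2 : ℝ)
  refine h2.congr_fderiv (ContinuousLinearMap.ext fun X => ?_)
  change (1 / 2 : ℝ) • (B (z - z₀) X + B X (z - z₀)) = B (z - z₀) X
  rw [hB X, ← two_smul ℝ, smul_smul]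
  norm_num

theorem contDiff_half_quadratic (B : F →L[ℝ] F →L[ℝ] G) (z₀ : F) :
    ContDiff ℝ ∞ fun z => (1 / 2 : ℝ) • B (z - z₀) (z - z₀) := by
  fun_prop

/-- The correction is the quadratic map of the symmetric form `U - t''`, centred at `z₀`, so the
value and the first derivative stay the same. -/
theorem exists_add_fderiv_fderiv_eq {t : F → G} {z₀ : F}
    (ht : ∀ᶠ z in 𝓝 z₀, ContDiffAt ℝ ∞ t z)
    {U : F →L[ℝ] F →L[ℝ] G} (hU : ∀ X Y, U X Y = U Y X) :
    ∃ f : F → G, ContDiff ℝ ∞ f ∧ f z₀ = 0 ∧ HasFDerivAt f (0 : F →L[ℝ] G) z₀ ∧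
      fderiv ℝ (fderiv ℝ fun z => t z + f z) z₀ = U := by
  have hT : IsSymmSndFDerivAt ℝ t z₀ :=
    ht.self_of_nhds.isSymmSndFDerivAt (by simpa using two_le_infty)
  let B := U - fderiv ℝ (fderiv ℝ t) z₀
  have hB : ∀ X Y, B X Y = B Y X := fun X Y => by
    simp only [B, sub_apply, hU X Y, hT.eq X Y]
  have hd := hasFDerivAt_half_quadratic hB z₀
  have h2 : fderiv ℝ (fun z => t z + (1 / 2 : ℝ) • B (z - z₀) (z - z₀)) =ᶠ[𝓝 z₀]
      fun z => fderiv ℝ t z + B (z - z₀) := by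
    filter_upwards [ht] with z hz
    exact ((hz.differentiableAt (by simp)).hasFDerivAt.add (hd z)).fderiv
  have h3 : DifferentiableAt ℝ (fderiv ℝ t) z₀ :=
    (ht.self_of_nhds.fderiv_right (m := ∞) (by simp)).differentiableAt (by simp)
  have h4 : HasFDerivAt (fun z => B (z - z₀)) B z₀ :=
    B.hasFDerivAt.comp z₀ ((hasFDerivAt_id z₀).sub_const z₀)
  refine ⟨_, contDiff_half_quadratic B z₀, by simp, by simpa using hd z₀, ?_⟩
  refine h2.fderiv_eq.trans ((h3.hasFDerivAt.add h4).fderiv.trans ?_)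
  simp [B]

end Model

variable {n : ℕ} {M : Type*} [TopologicalSpace M] [ChartedSpace (EuclideanSpace ℝ (Fin n)) M]
  [IsManifold (𝓡 n) ∞ M]
  {S : VField (𝓡 n).tangent (TangentBundle (𝓡 n) M)} {u : TangentBundle (𝓡 n) M}

theorem dR_eq_zero_iff_integrable (hS : IsSpray S) (hu : u ∈ slashed M) (θ : LocalSection u) :
    dR S θ.1 u = 0 ↔
      Integrable (fderiv ℝ (components θ.1 u) (extChartAt (𝓡 n).tangent u u))
        (coeff S u (extChartAt (𝓡 n).tangent u u))
        (fderiv ℝ (coeff S u) (extChartAt (𝓡 n).tangent u u)) :=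
  θ.eventually_semibasicNear.self_of_nhds.dR_eq_zero_iff hS hu

theorem LocalSection.fderiv_components_eq {θ θ' : LocalSection u}
    (h : Form.SameJet 1 u θ.1 θ'.1) :
    fderiv ℝ (components θ.1 u) (extChartAt (𝓡 n).tangent u u) =
      fderiv ℝ (components θ'.1 u) (extChartAt (𝓡 n).tangent u u) := by
  have key : ∀ η : LocalSection u,
      fderiv ℝ (components η.1 u) (extChartAt (𝓡 n).tangent u u) =
        horizontalPart ∘L fderiv ℝ (η.1.inChart u) (extChartAt (𝓡 n).tangent u u) := fun η =>
    ((horizontalPart (E := EuclideanSpace ℝ (Fin n))).hasFDerivAt.comp _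
      ((η.2.1.self_of_nhds.differentiableAt (by simp)).hasFDerivAt)).fderiv
  rw [key, key, (Form.sameJet_one_iff.1 h).2]

/-- A formal solution is defined through some representative of the jet; `FirstOrder` depends only
on the 1-jet, so every representative works. -/
theorem jet_mem_formalSolution_zero_iff (hS : IsSpray S) (hu : u ∈ slashed M)
    (θ : LocalSection u) : jet 1 θ ∈ FormalSolution S 0 u ↔ JetP1Vanishes S 0 u θ.1 := by
  constructor
  · rintro ⟨θ', h, h'⟩
    have h1 : Form.SameJet 1 u θ'.1 θ.1 := Quotient.exact h
    rw [jetP1Vanishes_zero_iff hS hu] at h' ⊢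
    rwa [← LocalSection.fderiv_components_eq h1]
  · exact fun h => ⟨θ, rfl, h⟩

theorem LocalSection.exists_add (θ : LocalSection u)
    {f : EuclideanSpace ℝ (Fin n) × EuclideanSpace ℝ (Fin n) → EuclideanSpace ℝ (Fin n) →L[ℝ] ℝ}
    (hf : ContDiff ℝ ∞ f) :
    ∃ θ' : LocalSection u, θ'.1.inChart u =ᶠ[𝓝 (extChartAt (𝓡 n).tangent u u)]
      fun z => θ.1.inChart u z + oneForm (semibasic (f z)) := by
  -- The form `f_i dxⁱ` in the chart at `u`. Outside the chart domain its values are irrelevant, as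
  -- only the germ at `u` counts.
  let α : Form (𝓡 n).tangent (TangentBundle (𝓡 n) M) 1 := fun v =>
    (oneForm (semibasic (f (extChartAt (𝓡 n).tangent u v)))).compContinuousLinearMap (dChart u v)
  have hα : α.inChart u =ᶠ[𝓝 (extChartAt (𝓡 n).tangent u u)]
      fun z => oneForm (semibasic (f z)) :=
    eventually_inChart (β := fun z => oneForm (semibasic (f z)))
      (Filter.Eventually.of_forall fun v => rfl)
  have he : Form.inChart (θ.1 + α) u =ᶠ[𝓝 (extChartAt (𝓡 n).tangent u u)]
      fun z => θ.1.inChart u z + oneForm (semibasic (f z)) := by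
    filter_upwards [hα] with z hz
    rw [← hz]
    rfl
  refine ⟨⟨θ.1 + α, ?_, ?_⟩, he⟩
  · filter_upwards [θ.2.1, eventually_eventually_nhds.2 he] with z hz hz'
    refine ContDiffAt.congr_of_eventuallyEq ?_ hz'
    exact hz.add
      (((oneForm (F := EuclideanSpace ℝ (Fin n) × EuclideanSpace ℝ (Fin n))).contDiff.comp
      ((semibasic (E := EuclideanSpace ℝ (Fin n))).contDiff.comp hf)).contDiffAt)
  · filter_upwards [θ.2.2, extChartAt_source_mem_nhds (I := (𝓡 n).tangent) u] with v hv hv' ξ hξ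
    have h1 : α v ![ξ] = 0 := by
      have h2 := (dProj_eq_zero_iff hv' ξ).1 hξ
      change f _ (dChart u v ξ).1 = 0
      rw [h2, map_zero]
    exact (congrArg₂ (· + ·) (hv ξ hξ) h1).trans (add_zero _)

theorem LocalSection.exists_sameJet_one (θ : LocalSection u)
    {U : EuclideanSpace ℝ (Fin n) × EuclideanSpace ℝ (Fin n) →L[ℝ]
      EuclideanSpace ℝ (Fin n) × EuclideanSpace ℝ (Fin n) →L[ℝ]
        EuclideanSpace ℝ (Fin n) →L[ℝ] ℝ} (hU : ∀ X Y, U X Y = U Y X) :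
    ∃ θ' : LocalSection u, Form.SameJet 1 u θ'.1 θ.1 ∧
      fderiv ℝ (fderiv ℝ (components θ'.1 u)) (extChartAt (𝓡 n).tangent u u) = U := by
  obtain ⟨f, hf, hf0, hf1, hf2⟩ :=
    exists_add_fderiv_fderiv_eq θ.eventually_contDiffAt hU
  obtain ⟨θ', hθ'⟩ := θ.exists_add hf
  refine ⟨θ', Form.sameJet_one_iff.2 ⟨?_, ?_⟩, ?_⟩
  · refine hθ'.self_of_nhds.trans ((congrArg (fun w => _ + oneForm (semibasic w)) hf0).trans ?_)
    simp
  · have h1 := (oneForm (F := EuclideanSpace ℝ (Fin n) × EuclideanSpace ℝ (Fin n))).hasFDerivAt.comp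
      _ ((semibasic (E := EuclideanSpace ℝ (Fin n))).hasFDerivAt.comp _ hf1)
    have h2 := (θ.2.1.self_of_nhds.differentiableAt (by simp)).hasFDerivAt.add h1
    refine hθ'.fderiv_eq.trans (h2.fderiv.trans ?_)
    simp
  · have h1 : components θ'.1 u =ᶠ[𝓝 (extChartAt (𝓡 n).tangent u u)]
        fun z => components θ.1 u z + f z := by
      filter_upwards [hθ'] with z hz
      rw [components, hz, map_add, horizontalPart_oneForm]
      rfl
    exact (Filter.EventuallyEq.fderiv (𝕜 := ℝ) h1).fderiv_eq.trans hf2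

/-- A lift `θ'` shares its first derivative with `θ`, so the integrability of `θ'` is that of `θ`.
Conversely, the algebraic `U` is realised as a second derivative over the same 1-jet. -/
theorem exists_solutionProj_eq_iff (hS : IsSpray S) (hu : u ∈ slashed M) (θ : LocalSection u)
    (hθ : jet 1 θ ∈ FormalSolution S 0 u) :
    (∃ j : FormalSolution S 1 u, solutionProj S 0 u j = ⟨jet 1 θ, hθ⟩) ↔ dR S θ.1 u = 0 := by
  rw [dR_eq_zero_iff_integrable hS hu]
  have hθ0 := (jet_mem_formalSolution_zero_iff hS hu θ).1 hθ
  have hd := extChartAt_mem_domain (mem_extChartAt_source u) hu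
  constructor
  · rintro ⟨⟨_, θ', rfl, h⟩, hj⟩
    have h1 : Form.SameJet 1 u θ'.1 θ.1 := Quotient.exact (congrArg Subtype.val hj)
    have hT : IsSymmSndFDerivAt ℝ (components θ'.1 u) (extChartAt (𝓡 n).tangent u u) :=
      θ'.eventually_contDiffAt.self_of_nhds.isSymmSndFDerivAt (by simpa using two_le_infty)
    rw [← LocalSection.fderiv_components_eq h1]
    exact ((jetP1Vanishes_one_iff hS hu θ').1 h).2.integrable hT.eq
  · intro h
    -- `hd.2` is the fact that the fibre coordinate of `u` is nonzero.
    obtain ⟨U, hU, hU'⟩ := h.exists_secondOrder ((jetP1Vanishes_zero_iff hS hu θ).1 hθ0) hd.2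
      (fun a b => fderiv_coeff_symm hS hd b a) (fun b => fderiv_coeff_vertical hS hd b)
    obtain ⟨θ', h1, h2⟩ := θ.exists_sameJet_one hU
    have h3 := LocalSection.fderiv_components_eq h1
    have h4 : JetP1Vanishes S 1 u θ'.1 := by
      rw [jetP1Vanishes_one_iff hS hu, jetP1Vanishes_zero_iff hS hu, h2, h3]
      exact ⟨(jetP1Vanishes_zero_iff hS hu θ).1 hθ0, hU'⟩
    exact ⟨⟨jet 2 θ', θ', rfl, h4⟩, Subtype.ext (Quotient.sound h1)⟩

end Spray

end

theorem mainTheorem3 {n : ℕ} {M : Type*} [TopologicalSpace M]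
    [ChartedSpace (EuclideanSpace ℝ (Fin n)) M] [IsManifold (𝓡 n) ∞ M]
    (S : FrolicherNijenhuis.VField (𝓡 n).tangent (TangentBundle (𝓡 n) M)) (hS : Spray.IsSpray S)
    (u : TangentBundle (𝓡 n) M) (hu : u ∈ Spray.slashed M) :
    (∀ (θ : Spray.LocalSection u) (hθ : Spray.jet 1 θ ∈ Spray.FormalSolution S 0 u),
      (∃ j : Spray.FormalSolution S 1 u, Spray.solutionProj S 0 u j = ⟨Spray.jet 1 θ, hθ⟩) ↔
        Spray.dR S θ.1 u = 0) ∧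
    (Function.Surjective (Spray.solutionProj S 0 u) ↔
      ∀ θ : Spray.LocalSection u, Spray.jet 1 θ ∈ Spray.FormalSolution S 0 u →
        Spray.dR S θ.1 u = 0) := by
  refine ⟨Spray.exists_solutionProj_eq_iff hS hu, fun h θ hθ =>
    (Spray.exists_solutionProj_eq_iff hS hu θ hθ).1 (h ⟨Spray.jet 1 θ, hθ⟩), ?_⟩
  -- Every first-order formal solution is the jet of a local section, so the pointwise criterion
  -- yields surjectivity.
  rintro h ⟨_, θ, rfl, hθ⟩
  exact (Spray.exists_solutionProj_eq_iff hS hu θ ⟨θ, rfl, hθ⟩).2 (h θ ⟨θ, rfl, hθ⟩)
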